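/- Let $d\ge 1$ and $c\in(0,1)$, and put $m=c^2$. Let $\mathbf Y=(Y_t)_{t\ge0}$ be Brownian motion in $\mathbb R^d$ started at $0$, normalized so that its transition density is $p_0(t;x,y)=(4\pi t)^{-d/2}e^{-|y-x|^2/(4t)}$, and let $T_1<T_2<\dots$ be the arrival times of a Poisson process of intensity $1$ independent of $\mathbf Y$. Let $\mathbf X$ be obtained from $\mathbf Y$ by partial resetting with factor $c$, that is, $X_t=Y_t$ for $t<T_1$ and $$X_t=c\,X_{T_n^-}+Y_t-Y_{T_n}\qquad\text{for } t\in[T_n,T_{n+1}),\ n\ge1 .$$ Write $(a;q)_n=\prod_{j=0}^{n-1}(1-aq^j)$, $(a;q)_\infty=\prod_{j=0}^{\infty}(1-aq^j)$, and, for $y\ne0$, $$\rho_{\mathbf Y}(y)=\frac1{(m;m)_\infty}\sum_{k=0}^\infty(-1)^k\frac{m^{k(k-1)/2}}{(m;m)_k}\int_0^\infty e^{-m^{-k}u}\,p_0(u;0,y)\,du .$$ Then for every $t>0$ the law of $X_t$ has a continuous density $p(t;0,\cdot)$ on $\mathbb R^d$. Moreover, for each $\delta>0$, $$p(t;0,y)=\rho_{\mathbf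 Y}(y)\,\bigl(1+\mathcal O(t^{-1})\bigr)$$ as $t\to\infty$, uniformly in the region $$\Bigl\{(t,y)\in(0,\infty)\times\mathbb R^d:\ m^2+\delta\le\frac{|y|^2}{4t^2}\le1-\delta\Bigr\},$$ and in the same region, also uniformly, both $p(t;0,y)$ and $\rho_{\mathbf Y}(y)$ are equal to $$\frac12\,\frac1{(m;m)_\infty}\,(2\pi)^{-\frac{d-1}2}\,|y|^{-\frac{d-1}2}\,e^{-|y|}\,\bigl(1+\mathcal O(t^{-1})\bigr).$$ Here the constants in $\mathcal O(t^{-1})$ and the threshold for $t$ depend only on $d$, $c$ and $\delta$. -/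

import Mathlib

open MeasureTheory ProbabilityTheory Filter Topology
open scoped NNReal ENNReal

noncomputable section

namespace PartialResetting

/-- The Euclidean space `ℝ^d`. -/
abbrev Space (d : ℕ) : Type := EuclideanSpace ℝ (Fin d)

/-- The transition density `p₀(t; x, y) = (4πt)^{-d/2} exp(-|y - x|² / (4t))` of Brownian motion
(with generator `Δ`), for `t > 0`. -/
def heatKernel (d : ℕ) (t : ℝ) (x y : Space d) : ℝ :=
  (4 * Real.pi * t) ^ (-(d : ℝ) / 2) * Real.exp (-‖y - x‖ ^ 2 / (4 * t))

/-- `Y` is a Brownian motion in `ℝ^d` started at `x`, with transition density `heatKernel`. -/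
structure IsBrownianMotion {d : ℕ} {Ω : Type*} [MeasurableSpace Ω]
    (x : Space d) (Y : ℝ≥0 → Ω → Space d) (P : Measure Ω) : Prop where
  measurable : ∀ t, Measurable (Y t)
  start : ∀ᵐ ω ∂P, Y 0 ω = x
  indep_increments : HasIndepIncrements Y P
  law_increment : ∀ s t : ℝ≥0, s < t →
    HasLaw (fun ω => Y t ω - Y s ω)
      (volume.withDensity fun y => ENNReal.ofReal (heatKernel d ((t : ℝ) - s) 0 y)) P
  continuous_paths : ∀ᵐ ω ∂P, Continuous fun t => Y t ω

/-- `T 1, T 2, …` are the arrival times of a Poisson process of intensity `1`: with `T 0 = 0`,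
the waiting times `T (n + 1) - T n` are independent exponential variables of mean `1`. -/
structure IsPoissonArrivals {Ω : Type*} [MeasurableSpace Ω]
    (T : ℕ → Ω → ℝ≥0) (P : Measure Ω) : Prop where
  measurable : ∀ n, Measurable (T n)
  zero : ∀ᵐ ω ∂P, T 0 ω = 0
  indep_waiting : iIndepFun (fun n ω => (T (n + 1) ω : ℝ) - T n ω) P
  law_waiting : ∀ n, HasLaw (fun ω => (T (n + 1) ω : ℝ) - T n ω) (expMeasure 1) P

/-- `X` is obtained from `Y` by partial resetting with factor `c` at the times `T 1, T 2, …`: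
almost surely `X = Y` before `T 1`, and on `[T n, T (n + 1))` with `n ≥ 1` one has
`X t = c X_{T n -} + Y t - Y_{T n}`, where `ℓ = X_{T n -}` is the left limit of `X` at `T n`. -/
def IsPartialResettingOf {d : ℕ} {Ω : Type*} [MeasurableSpace Ω] (c : ℝ)
    (Y : ℝ≥0 → Ω → Space d) (T : ℕ → Ω → ℝ≥0) (X : ℝ≥0 → Ω → Space d) (P : Measure Ω) : Prop :=
  ∀ᵐ ω ∂P,
    (∀ t, t < T 1 ω → X t ω = Y t ω) ∧
    ∀ n, 1 ≤ n → ∃ ℓ : Space d, Tendsto (fun t => X t ω) (𝓝[<] (T n ω)) (𝓝 ℓ) ∧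
      ∀ t, T n ω ≤ t → t < T (n + 1) ω → X t ω = c • ℓ + (Y t ω - Y (T n ω) ω)

/-- `X` is Brownian motion started at `x` with partial resetting with factor `c`: it is obtained
from a Brownian motion `Y` and the arrival times `T` of an independent Poisson process. -/
structure IsResetBrownianMotion {d : ℕ} {Ω : Type*} [MeasurableSpace Ω] (c : ℝ) (x : Space d)
    (Y : ℝ≥0 → Ω → Space d) (T : ℕ → Ω → ℝ≥0) (X : ℝ≥0 → Ω → Space d) (P : Measure Ω) :
    Prop where
  brownian : IsBrownianMotion x Y P
  poisson : IsPoissonArrivals T P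
  indep : IndepFun (fun ω t => Y t ω) (fun ω n => T n ω) P
  resetting : IsPartialResettingOf c Y T X P

/-- For each `t > 0`, `q t` is the continuous density of the law of `X t`. If `X` starts at `x`,
then `q t y` is the value `p(t; x, y)` of its transition density. -/
def IsDensityOf {d : ℕ} {Ω : Type*} [MeasurableSpace Ω]
    (q : ℝ≥0 → Space d → ℝ) (X : ℝ≥0 → Ω → Space d) (P : Measure Ω) : Prop :=
  ∀ t, 0 < t → Continuous (q t) ∧ (∀ y, 0 ≤ q t y) ∧
    HasLaw (X t) (volume.withDensity fun y => ENNReal.ofReal (q t y)) P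

/-- The finite `q`-Pochhammer symbol `(a; q)_n`. -/
def qPochhammer (a q : ℝ) (n : ℕ) : ℝ := ∏ j ∈ Finset.range n, (1 - a * q ^ j)

/-- The infinite `q`-Pochhammer symbol `(a; q)_∞`, for `|q| < 1`. -/
def qPochhammerInf (a q : ℝ) : ℝ := ∏' j : ℕ, (1 - a * q ^ j)

/-- The potential kernel `U^{(β)}(y) = ∫_0^∞ e^{-βu} p₀(u; 0, y) du`, for `β > 0` and `y ≠ 0`. -/
def potential (d : ℕ) (β : ℝ) (y : Space d) : ℝ :=
  ∫ u in Set.Ioi (0 : ℝ), Real.exp (-β * u) * heatKernel d u 0 y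

/-- The density `ρ_Y` of the ergodic measure, with `m = c²`, for `y ≠ 0`. -/
def rho (d : ℕ) (m : ℝ) (y : Space d) : ℝ :=
  1 / qPochhammerInf m m *
    ∑' k : ℕ, (-1) ^ k * (m ^ (k.choose 2) / qPochhammer m m k) * potential d (m ^ k)⁻¹ y

/-- The leading term `½ (m; m)_∞⁻¹ (2π)^{-(d-1)/2} |y|^{-(d-1)/2} e^{-|y|}`. -/
def leadingTerm (d : ℕ) (m : ℝ) (y : Space d) : ℝ :=
  1 / 2 * (1 / qPochhammerInf m m) * (2 * Real.pi) ^ (-((d : ℝ) - 1) / 2) *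
    ‖y‖ ^ (-((d : ℝ) - 1) / 2) * Real.exp (-‖y‖)

end PartialResetting

end

/-! Given the reset times, `X t` is a sum of independent Gaussian increments, each scaled by the
power of `c` collected from the later resets. Hence it is distributed as Brownian motion at a random
time `U`, its variance parameter. If `n` resets occur before `t` and `w 0, w 1, …` are the waiting
times between them, listed backwards, then `U = t - ∑ (1 - m^(i+1)) w i`. On this event the waiting
times have density `e^{-t}` on the simplex `∑ w i ≤ t`. So `p(t; 0, y)` is the mixture of `p₀(u; 0,
y)` over the law of `U` (`clockLaw`), and the problem becomes one-dimensional.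

The key fact is that `clockLaw` is close to `(m; m)_∞⁻¹ e^{-u} du` on `(0, t)`. Rescaling to `v i =
(1 - m^(i+1)) w i` produces the Jacobian `1 / (m; m)_n` and the function `t - ∑ v i`. If the simplex
constraint is relaxed to `∑ v i < t`, the sum of the coordinates has density `s^(n-1) / (n-1)!`, and
summation over `n ≥ 1` gives `e^{-t} e^s = e^{-u}` with `u = t - s`. This is an upper bound, up to
the atom at `u = t` for no reset (`lintegral_clockLaw_le`). The relaxation overcounts only where `t
- ∑ v i ≤ ∑ l i v i`, with `l i` geometrically small, so a Markov-type inequality bounds the excess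
by a relative error of order `1/u`. Replacing `(m; m)_n` by its limit costs a term that is
exponentially small near the saddle (`le_lintegral_clockLaw_add`).

Integrating the heat kernel against `e^{-u} du` gives the potential kernel with `β = 1`, a Macdonald
function, which the Laplace method evaluates with relative error `1/|y|`
(`abs_besselIntegral_sub_le`). The relative error `1/u` raises the index of that integral by one and
so gains a factor `2/|y|`. In the region, `|y|` lies between `2√δ t` and `2√(1-δ) t`: the saddle `u
= |y|/2` stays below `t`, the atom and the boundary terms are exponentially smaller than `e^{-|y|}`,
and `1/|y|` is of order `1/t`. Finally, the `k = 0` term of `ρ_Y` is the same multiple of the same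
potential kernel, and the later terms have rates `m^{-k} > 1`, so they decay faster
(`abs_rho_sub_le`). -/

noncomputable section

namespace PartialResetting

/-! ### Laplace asymptotics of the Macdonald integral -/

/-- The integral `∫_0^∞ u^{-a} e^{-u - r²/(4u)} du`, a multiple of a Macdonald function. -/
def besselIntegral (a r : ℝ) : ℝ :=
  ∫ u in Set.Ioi (0 : ℝ), u ^ (-a) * Real.exp (-u - r ^ 2 / (4 * u))

/-- With `u = (r/2) e^{2θ}` the exponent is `-r cosh 2θ = -r - 2r sinh² θ`. The variable `w = sinh
θ` therefore makes it exactly Gaussian, with the saddle `u = r/2` at `w = 0`. -/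
theorem besselIntegral_eq_gaussian {a r : ℝ} (hr : 0 < r) :
    besselIntegral a r = 2 * (r / 2) ^ (1 - a) * Real.exp (-r) *
      ∫ w : ℝ, Real.exp (-(2 * r) * w ^ 2) *
        (Real.exp ((2 - 2 * a) * Real.arsinh w) / √(1 + w ^ 2)) := by
  set f : ℝ → ℝ := fun w => r / 2 * Real.exp (2 * Real.arsinh w) with hf
  have hder : ∀ w ∈ Set.univ, HasDerivWithinAt f
      (r / 2 * (Real.exp (2 * Real.arsinh w) * (2 * (√(1 + w ^ 2))⁻¹))) Set.univ w := by
    intro w _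
    exact ((((Real.hasDerivAt_arsinh w).const_mul 2).exp).const_mul (r / 2)).hasDerivWithinAt
  have hinj : Set.InjOn f Set.univ := by
    intro x _ y _ h
    have := mul_left_cancel₀ (by positivity) h
    have := Real.exp_injective this
    exact Real.arsinh_injective (by linarith)
  have himg : Set.image f Set.univ = Set.Ioi 0 := by
    ext x
    simp only [Set.image_univ, Set.mem_range, Set.mem_Ioi, hf]
    constructor
    · rintro ⟨w, rfl⟩; positivity
    · intro hx
      refine ⟨Real.sinh (Real.log (x / (r / 2)) / 2), ?_⟩
      rw [Real.arsinh_sinh, mul_div_cancel₀ _ two_ne_zero, Real.exp_log (by positivity)]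
      field_simp
  have key := integral_image_eq_integral_abs_deriv_smul MeasurableSet.univ hder hinj
    (fun u => u ^ (-a) * Real.exp (-u - r ^ 2 / (4 * u)))
  rw [himg] at key
  rw [besselIntegral, key, Measure.restrict_univ, ← integral_const_mul]
  congr 1 with w
  obtain ⟨θ, rfl⟩ := Real.sinh_surjective w
  have hE : 0 < Real.exp θ := Real.exp_pos θ
  have h1 : f (Real.sinh θ) = r / 2 * Real.exp (2 * θ) := by simp [hf]
  have h2 : (f (Real.sinh θ)) ^ (-a) = (r / 2) ^ (-a) * Real.exp (-(2 * a * θ)) := by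
    rw [h1, Real.mul_rpow (by positivity) (by positivity), ← Real.exp_mul]
    ring_nf
  have h3 : -f (Real.sinh θ) - r ^ 2 / (4 * f (Real.sinh θ))
      = -r + -(2 * r) * Real.sinh θ ^ 2 := by
    rw [h1, Real.sinh_eq, two_mul θ, Real.exp_add, Real.exp_neg]
    field_simp
    ring
  have h4 : (r / 2) ^ (1 - a) = r / 2 * (r / 2) ^ (-a) := by
    rw [sub_eq_add_neg, Real.rpow_add (by positivity), Real.rpow_one]
  have h5 : Real.exp ((2 - 2 * a) * θ) = Real.exp (2 * θ) * Real.exp (-(2 * a * θ)) := by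
    rw [← Real.exp_add]; ring_nf
  rw [h2, h3, h4, Real.arsinh_sinh, h5, Real.exp_add, abs_of_pos (by positivity), smul_eq_mul]
  field_simp

theorem abs_arsinh_le (w : ℝ) : |Real.arsinh w| ≤ |w| := by
  obtain ⟨θ, rfl⟩ := Real.sinh_surjective w
  rw [Real.arsinh_sinh]
  rcases le_total 0 θ with h | h
  · rw [abs_of_nonneg h, abs_of_nonneg (Real.sinh_nonneg_iff.2 h)]
    exact Real.self_le_sinh_iff.2 h
  · rw [abs_of_nonpos h, abs_of_nonpos (Real.sinh_nonpos_iff.2 h), neg_le_neg_iff]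
    exact Real.sinh_le_self_iff.2 h

/-- The function is even in `w`, so its deviation from `1` is of second order. The upper bound comes
from `cosh x ≤ e^{x²/2}` and `|arsinh w| ≤ |w|`, the lower one from `√(1 + w²) ≤ 1 + w²/2`. -/
theorem cosh_arsinh_div_sqrt_bound (b w : ℝ) :
    |Real.cosh (b * Real.arsinh w) / √(1 + w ^ 2) - 1|
      ≤ (b ^ 2 + 1) / 2 * w ^ 2 * Real.exp (b ^ 2 * w ^ 2 / 2) := by
  have hs1 : 1 ≤ √(1 + w ^ 2) := Real.one_le_sqrt.2 (by nlinarith [sq_nonneg w])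
  have hs2 : √(1 + w ^ 2) ≤ 1 + w ^ 2 / 2 := by
    rw [Real.sqrt_le_left (by positivity)]; nlinarith [sq_nonneg (w ^ 2)]
  have hc1 : 1 ≤ Real.cosh (b * Real.arsinh w) := Real.one_le_cosh _
  have harg : (b * Real.arsinh w) ^ 2 / 2 ≤ b ^ 2 * w ^ 2 / 2 := by
    have : Real.arsinh w ^ 2 ≤ w ^ 2 := sq_le_sq.2 (abs_arsinh_le w)
    have := mul_le_mul_of_nonneg_left this (sq_nonneg b)
    nlinarith
  have hc2 : Real.cosh (b * Real.arsinh w) ≤ Real.exp (b ^ 2 * w ^ 2 / 2) :=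
    (Real.cosh_le_exp_half_sq _).trans (Real.exp_le_exp.2 harg)
  set x := b ^ 2 * w ^ 2 / 2 with hx
  have hx0 : 0 ≤ x := by positivity
  have he : Real.exp x - 1 ≤ x * Real.exp x := by
    have := Real.add_one_le_exp (-x)
    have h2 : Real.exp (-x) * Real.exp x = 1 := by rw [← Real.exp_add]; simp
    nlinarith [Real.exp_pos x]
  have he1 : 1 ≤ Real.exp x := Real.one_le_exp hx0
  have hrhs : (b ^ 2 + 1) / 2 * w ^ 2 * Real.exp x = x * Real.exp x + w ^ 2 / 2 * Real.exp x := by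
    rw [hx]; ring
  rw [hrhs, abs_le]
  constructor
  · have : 1 - w ^ 2 / 2 ≤ Real.cosh (b * Real.arsinh w) / √(1 + w ^ 2) := by
      rw [le_div_iff₀ (by positivity)]
      nlinarith [sq_nonneg w]
    nlinarith [sq_nonneg w, mul_nonneg hx0 (Real.exp_pos x).le]
  · have : Real.cosh (b * Real.arsinh w) / √(1 + w ^ 2) ≤ Real.exp x := by
      rw [div_le_iff₀ (by positivity)]
      nlinarith
    nlinarith [sq_nonneg w]

theorem sq_mul_exp_neg_le {r w : ℝ} (hr : 0 < r) :
    w ^ 2 * Real.exp (-r * w ^ 2) ≤ 2 / r * Real.exp (-(r / 2) * w ^ 2) := by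
  have h := Real.add_one_le_exp (r / 2 * w ^ 2)
  have h2 : w ^ 2 ≤ 2 / r * Real.exp (r / 2 * w ^ 2) := by
    rw [div_mul_eq_mul_div, le_div_iff₀ hr]; nlinarith
  calc w ^ 2 * Real.exp (-r * w ^ 2)
      ≤ 2 / r * Real.exp (r / 2 * w ^ 2) * Real.exp (-r * w ^ 2) := by gcongr
    _ = _ := by rw [mul_assoc, ← Real.exp_add]; ring_nf

theorem integrable_exp_arsinh {r b : ℝ} (hr : b ^ 2 ≤ r) (hr0 : 0 < r) :
    Integrable fun w : ℝ => Real.exp (-(2 * r) * w ^ 2) *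
        (Real.exp (b * Real.arsinh w) / √(1 + w ^ 2)) := by
  refine ((integrable_exp_neg_mul_sq hr0).const_mul 2).mono' ?_ (ae_of_all _ fun w => ?_)
  · have : Continuous fun w : ℝ => Real.exp (-(2 * r) * w ^ 2) *
        (Real.exp (b * Real.arsinh w) / √(1 + w ^ 2)) := by
      refine Continuous.mul (by fun_prop) (Continuous.div ?_ (by fun_prop) fun w => by positivity)
      exact Real.continuous_exp.comp (Real.continuous_arsinh.const_mul b)
    exact this.aestronglyMeasurable
  · have hs1 : 1 ≤ √(1 + w ^ 2) := Real.one_le_sqrt.2 (by nlinarith [sq_nonneg w])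
    have harg : (b * Real.arsinh w) ^ 2 / 2 ≤ r * w ^ 2 := by
      have h1 : Real.arsinh w ^ 2 ≤ w ^ 2 := sq_le_sq.2 (abs_arsinh_le w)
      have h2 := mul_le_mul hr h1 (sq_nonneg _) hr0.le
      nlinarith [mul_nonneg (sq_nonneg b) (sq_nonneg (Real.arsinh w))]
    have hc : Real.exp (b * Real.arsinh w) ≤ 2 * Real.exp (r * w ^ 2) := by
      have h1 := (Real.cosh_le_exp_half_sq (b * Real.arsinh w)).trans (Real.exp_le_exp.2 harg)
      rw [Real.cosh_eq] at h1
      linarith [Real.exp_pos (-(b * Real.arsinh w))]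
    rw [Real.norm_of_nonneg (by positivity)]
    calc Real.exp (-(2 * r) * w ^ 2) * (Real.exp (b * Real.arsinh w) / √(1 + w ^ 2))
        ≤ Real.exp (-(2 * r) * w ^ 2) * (2 * Real.exp (r * w ^ 2)) := by
          gcongr
          exact (div_le_self (Real.exp_pos _).le hs1).trans hc
      _ = 2 * Real.exp (-r * w ^ 2) := by
          rw [mul_left_comm, ← Real.exp_add]; ring_nf

/-- The exponential has a term linear in `w`, which bounded in absolute value would cost `r^{-1/2}`.
The symmetry `w ↦ -w` replaces it by its even part `cosh`, and the second-order bound then gives a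
relative error `1/r`. The condition `b² ≤ r` lets the Gaussian absorb `e^{b²w²/2}`. -/
theorem abs_integral_gaussian_arsinh_sub_le {r b : ℝ} (hr : b ^ 2 ≤ r) (hr0 : 0 < r) :
    |(∫ w : ℝ, Real.exp (-(2 * r) * w ^ 2) * (Real.exp (b * Real.arsinh w) / √(1 + w ^ 2)))
      - √(Real.pi / (2 * r))| ≤ 2 * (b ^ 2 + 1) / r * √(Real.pi / (2 * r)) := by
  have hi := integrable_exp_arsinh hr hr0
  have hi' := integrable_exp_arsinh (b := -b) (by simpa using hr) hr0
  have hsymm : (∫ w : ℝ, Real.exp (-(2 * r) * w ^ 2) * (Real.exp (-b * Real.arsinh w) / √(1 + w ^ 2)))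
      = ∫ w : ℝ, Real.exp (-(2 * r) * w ^ 2) * (Real.exp (b * Real.arsinh w) / √(1 + w ^ 2)) := by
    rw [← integral_neg_eq_self]
    congr 1 with w
    simp
  have hcosh : (∫ w : ℝ, Real.exp (-(2 * r) * w ^ 2) *
        (Real.exp (b * Real.arsinh w) / √(1 + w ^ 2)))
      = ∫ w : ℝ, Real.exp (-(2 * r) * w ^ 2) * (Real.cosh (b * Real.arsinh w) / √(1 + w ^ 2)) := by
    have h := integral_add hi hi'
    rw [hsymm] at h
    rw [eq_comm, ← mul_right_inj' (two_ne_zero' ℝ), two_mul (∫ w : ℝ, _ * (Real.exp _ / _)), ← h,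
      ← integral_const_mul]
    congr 1 with w
    rw [Real.cosh_eq, neg_mul]
    ring_nf
  have hic : Integrable fun w : ℝ =>
      Real.exp (-(2 * r) * w ^ 2) * (Real.cosh (b * Real.arsinh w) / √(1 + w ^ 2)) := by
    refine ((hi.add hi').const_mul (1 / 2)).congr (ae_of_all _ fun w => ?_)
    simp only [Pi.add_apply, Real.cosh_eq, neg_mul]
    ring
  have hg := integrable_exp_neg_mul_sq (b := 2 * r) (by positivity)
  rw [hcosh, ← integral_gaussian, ← integral_sub hic hg]
  -- Absorbing `w²` into the Gaussian leaves the rate `r/2`, and its integral is twice that at rate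
  -- `2r`.
  have hsq : √(Real.pi / (r / 2)) = 2 * √(Real.pi / (2 * r)) := by
    rw [show Real.pi / (r / 2) = 2 ^ 2 * (Real.pi / (2 * r)) by field_simp,
      Real.sqrt_mul (by norm_num), Real.sqrt_sq (by norm_num)]
  calc |∫ w : ℝ, (Real.exp (-(2 * r) * w ^ 2) * (Real.cosh (b * Real.arsinh w) / √(1 + w ^ 2))
          - Real.exp (-(2 * r) * w ^ 2))|
      ≤ ∫ w : ℝ, (b ^ 2 + 1) / 2 * (2 / r * Real.exp (-(r / 2) * w ^ 2)) := by
        rw [← Real.norm_eq_abs]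
        refine norm_integral_le_of_norm_le
          (((integrable_exp_neg_mul_sq (by positivity)).const_mul _).const_mul _)
          (ae_of_all _ fun w => ?_)
        rw [Real.norm_eq_abs, ← mul_sub_one, abs_mul, abs_of_pos (Real.exp_pos _)]
        calc _ ≤ Real.exp (-(2 * r) * w ^ 2) *
              ((b ^ 2 + 1) / 2 * w ^ 2 * Real.exp (b ^ 2 * w ^ 2 / 2)) := by
              gcongr
              exact cosh_arsinh_div_sqrt_bound b w
          _ = (b ^ 2 + 1) / 2 * (w ^ 2 * Real.exp (-(2 * r) * w ^ 2 + b ^ 2 * w ^ 2 / 2)) := by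
              rw [Real.exp_add]; ring
          _ ≤ (b ^ 2 + 1) / 2 * (w ^ 2 * Real.exp (-r * w ^ 2)) := by
              gcongr
              nlinarith [mul_le_mul_of_nonneg_right hr (sq_nonneg w), mul_nonneg hr0.le (sq_nonneg w)]
          _ ≤ _ := by
              exact mul_le_mul_of_nonneg_left (sq_mul_exp_neg_le hr0) (by positivity)
    _ = 2 * (b ^ 2 + 1) / r * √(Real.pi / (2 * r)) := by
        rw [integral_const_mul, integral_const_mul, integral_gaussian, hsq]
        field_simp
    _ = _ := by rw [integral_gaussian]

/-- The leading term of `besselIntegral a r` as `r → ∞`. -/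
def besselLeading (a r : ℝ) : ℝ :=
  2 * (r / 2) ^ (1 - a) * Real.exp (-r) * √(Real.pi / (2 * r))

theorem besselLeading_pos {a r : ℝ} (hr : 0 < r) : 0 < besselLeading a r := by
  unfold besselLeading; have := Real.pi_pos; positivity

theorem abs_besselIntegral_sub_le {a r : ℝ} (hr : (2 - 2 * a) ^ 2 ≤ r) (hr0 : 0 < r) :
    |besselIntegral a r - besselLeading a r|
      ≤ 2 * ((2 - 2 * a) ^ 2 + 1) / r * besselLeading a r := by
  rw [besselIntegral_eq_gaussian hr0, besselLeading, ← mul_sub, abs_mul,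
    abs_of_pos (by positivity : 0 < 2 * (r / 2) ^ (1 - a) * Real.exp (-r)), mul_left_comm]
  gcongr
  exact abs_integral_gaussian_arsinh_sub_le hr hr0

/-- This is how a weight `1/u` inside the integral becomes a relative error of order `1/r`. -/
theorem besselLeading_add_one {a r : ℝ} (hr : 0 < r) :
    besselLeading (a + 1) r = 2 / r * besselLeading a r := by
  rw [besselLeading, besselLeading, show 1 - a = (1 - (a + 1)) + 1 by ring,
    Real.rpow_add_one (by positivity)]
  field_simp

theorem leadingTerm_eq_besselLeading {d : ℕ} {m : ℝ} {y : Space d} (hy : y ≠ 0) :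
    leadingTerm d m y = 1 / qPochhammerInf m m *
      ((4 * Real.pi) ^ (-(d : ℝ) / 2) * besselLeading (d / 2) ‖y‖) := by
  have hr : 0 < ‖y‖ := norm_pos_iff.2 hy
  set r := ‖y‖ with hrd
  have hpi := Real.pi_pos
  have h1 : r ^ (-((d : ℝ) - 1) / 2) = r ^ (-(d : ℝ) / 2) * √r := by
    rw [Real.sqrt_eq_rpow, ← Real.rpow_add hr]; ring_nf
  have h2 : (2 * Real.pi) ^ (-((d : ℝ) - 1) / 2) = (2 * Real.pi) ^ (-(d : ℝ) / 2) * √(2 * Real.pi) := by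
    rw [Real.sqrt_eq_rpow, ← Real.rpow_add (by positivity)]; ring_nf
  have h3 : (4 * Real.pi) ^ (-(d : ℝ) / 2) = 2 ^ (-(d : ℝ) / 2) * (2 * Real.pi) ^ (-(d : ℝ) / 2) := by
    rw [← Real.mul_rpow (by positivity) (by positivity)]; ring_nf
  have h4 : (r / 2) ^ (1 - (d : ℝ) / 2) = r / 2 * (r ^ (-(d : ℝ) / 2) * (2 ^ (-(d : ℝ) / 2))⁻¹) := by
    rw [sub_eq_add_neg, Real.rpow_add (by positivity), Real.rpow_one, ← neg_div,
      Real.div_rpow hr.le (by positivity), div_eq_mul_inv (r ^ _)]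
  have h5 : √(Real.pi / (2 * r)) = √(2 * Real.pi) * √r / (2 * r) := by
    rw [← Real.sqrt_mul (by positivity), Real.sqrt_eq_iff_mul_self_eq (by positivity) (by positivity)]
    have := Real.mul_self_sqrt (show 0 ≤ 2 * Real.pi * r by positivity)
    rw [div_mul_div_comm, this]
    field_simp
  rw [leadingTerm, besselLeading, ← hrd, h1, h2, h3, h4, h5]
  have : (2 : ℝ) ^ (-(d : ℝ) / 2) ≠ 0 := by positivity
  field_simp

/-! ### Exponential decay of the potential kernels -/

theorem rpow_neg_mul_exp_le {a b u : ℝ} (ha : 0 < a) (hb : 0 < b) (hu : 0 < u) :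
    u ^ (-a) * Real.exp (-b / u) ≤ (a / b) ^ a := by
  -- The bound is `x ≤ e^x` at `x = b / (a u)`, raised to the power `a`.
  have h1 : b / (a * u) ≤ Real.exp (b / (a * u)) := by
    linarith [Real.add_one_le_exp (b / (a * u))]
  have h2 : (b / (a * u)) ^ a ≤ Real.exp (b / u) := by
    refine (Real.rpow_le_rpow (by positivity) h1 ha.le).trans_eq ?_
    rw [← Real.exp_mul]; congr 1; field_simp
  have h3 : u ^ (-a) = (a / b) ^ a * (b / (a * u)) ^ a := by
    rw [← Real.mul_rpow (by positivity) (by positivity), Real.rpow_neg hu.le, ← Real.inv_rpow hu.le]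
    congr 1; field_simp
  rw [h3, mul_assoc]
  refine mul_le_of_le_one_right (by positivity) ?_
  calc _ ≤ Real.exp (b / u) * Real.exp (-b / u) := by gcongr
    _ = 1 := by rw [← Real.exp_add, neg_div, add_neg_cancel, Real.exp_zero]

/-- Pointwise form of the exponential decay `e^{-√β r}` of the potential kernels. -/
theorem exists_pointwise_exp_bound {a β γ : ℝ} (ha : 0 < a) (hβ : γ ^ 2 < β) :
    ∃ K ε : ℝ, 0 < K ∧ 0 < ε ∧ ∀ r u : ℝ, 1 ≤ r → 0 < u →
      Real.exp (-β * u) * (u ^ (-a) * Real.exp (-r ^ 2 / (4 * u)))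
        ≤ K * Real.exp (-γ * r) * Real.exp (-ε * u) := by
  have hβ0 : 0 < β := (sq_nonneg γ).trans_lt hβ
  -- This `ε` is small enough for `(β - ε)(1 - ε) ≥ γ²`, and the shares `ε u` and `ε r² / (4u)` of
  -- the exponent stay in reserve.
  set ε := (β - γ ^ 2) / (1 + β) / 2 with hε
  have hε0 : 0 < ε := by have := sub_pos.2 hβ; positivity
  have hε2 : 2 * ε * (1 + β) = β - γ ^ 2 := by rw [hε]; field_simp
  have hε1 : 2 * ε < 1 := by nlinarith [sq_nonneg γ]
  have hβε : 0 < β - 2 * ε := by nlinarith [sq_nonneg γ]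
  refine ⟨(a / (ε / 4)) ^ a, ε, by positivity, hε0, fun r u hr hu => ?_⟩
  have hprod : γ ^ 2 ≤ (β - ε) * (1 - ε) := by nlinarith
  -- AM-GM: the two summands have product `(β - ε)(1 - ε) r² / 4 ≥ (γ r / 2)²`.
  have key : γ * r ≤ (β - ε) * u + (1 - ε) * (r ^ 2 / (4 * u)) := by
    have hA : 0 ≤ (β - ε) * u := by nlinarith [mul_pos hβε hu, mul_pos hε0 hu]
    have hB : 0 ≤ (1 - ε) * (r ^ 2 / (4 * u)) := mul_nonneg (by linarith) (by positivity)
    refine abs_le_of_sq_le_sq' ?_ (add_nonneg hA hB) |>.2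
    have hAB : (β - ε) * u * ((1 - ε) * (r ^ 2 / (4 * u))) = (β - ε) * (1 - ε) * r ^ 2 / 4 := by
      field_simp
    nlinarith [sq_nonneg ((β - ε) * u - (1 - ε) * (r ^ 2 / (4 * u))),
      mul_le_mul_of_nonneg_right hprod (sq_nonneg r)]
  have hb := rpow_neg_mul_exp_le ha (by positivity : 0 < ε / 4) hu
  -- As `r ≥ 1`, the second reserve is at least `(ε/4)/u`, which compensates the singularity of
  -- `u^{-a}` at `0`.
  have hr2 : ε / 4 / u ≤ ε * (r ^ 2 / (4 * u)) := by
    rw [div_div, ← mul_div_assoc]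
    gcongr
    nlinarith [mul_nonneg hε0.le (show 0 ≤ r ^ 2 - 1 by nlinarith)]
  have e1 : Real.exp (-β * u) * Real.exp (-r ^ 2 / (4 * u))
      ≤ Real.exp (-γ * r) * Real.exp (-ε * u) * Real.exp (-(ε / 4) / u) := by
    rw [← Real.exp_add, ← Real.exp_add, ← Real.exp_add, Real.exp_le_exp, neg_div, neg_div]
    linarith
  calc _ = u ^ (-a) * (Real.exp (-β * u) * Real.exp (-r ^ 2 / (4 * u))) := by ring
    _ ≤ u ^ (-a) * (Real.exp (-γ * r) * Real.exp (-ε * u) * Real.exp (-(ε / 4) / u)) := by gcongr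
    _ = u ^ (-a) * Real.exp (-(ε / 4) / u) * Real.exp (-γ * r) * Real.exp (-ε * u) := by ring
    _ ≤ _ := by gcongr

theorem heatKernel_eq {d : ℕ} {u : ℝ} (hu : 0 < u) (y : Space d) :
    heatKernel d u 0 y = (4 * Real.pi) ^ (-(d : ℝ) / 2) *
      (u ^ (-((d : ℝ) / 2)) * Real.exp (-‖y‖ ^ 2 / (4 * u))) := by
  rw [heatKernel, sub_zero, Real.mul_rpow (by positivity) hu.le, mul_assoc, neg_div]

theorem heatKernel_nonneg {d : ℕ} {u : ℝ} (hu : 0 ≤ u) (x y : Space d) : 0 ≤ heatKernel d u x y := by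
  unfold heatKernel; positivity

theorem measurable_heatKernel_left {d : ℕ} (x y : Space d) :
    Measurable fun u => heatKernel d u x y := by
  unfold heatKernel; fun_prop

theorem measurable_exp_rpow_exp (a β r : ℝ) : Measurable fun u : ℝ =>
    Real.exp (-β * u) * (u ^ (-a) * Real.exp (-r ^ 2 / (4 * u))) := by fun_prop

theorem integrableOn_exp_rpow_exp {a β r : ℝ} (ha : 0 < a) (hβ : 0 < β) (hr : 1 ≤ r) :
    IntegrableOn (fun u : ℝ => Real.exp (-β * u) * (u ^ (-a) * Real.exp (-r ^ 2 / (4 * u))))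
      (Set.Ioi 0) := by
  obtain ⟨K, ε, -, hε, h⟩ := exists_pointwise_exp_bound ha (by simpa using hβ : (0 : ℝ) ^ 2 < β)
  refine ((integrableOn_exp_mul_Ioi (neg_lt_zero.2 hε) 0).const_mul
    (K * Real.exp (-0 * r))).mono' (measurable_exp_rpow_exp a β r).aestronglyMeasurable ?_
  filter_upwards [ae_restrict_mem measurableSet_Ioi] with u hu
  have hu : 0 < u := hu
  rw [Real.norm_of_nonneg (by positivity)]
  exact h r u hr hu

theorem integrableOn_potential {d : ℕ} (hd : 1 ≤ d) {β : ℝ} (hβ : 0 < β) {y : Space d}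
    (hy : 1 ≤ ‖y‖) :
    IntegrableOn (fun u => Real.exp (-β * u) * heatKernel d u 0 y) (Set.Ioi 0) := by
  have hd' : (0 : ℝ) < d / 2 := by positivity
  refine IntegrableOn.congr_fun ((integrableOn_exp_rpow_exp hd' hβ hy).const_mul
    ((4 * Real.pi) ^ (-(d : ℝ) / 2))) (fun u hu => ?_) measurableSet_Ioi
  simp only [heatKernel_eq (Set.mem_Ioi.1 hu)]
  ring

theorem potential_nonneg (d : ℕ) (β : ℝ) (y : Space d) : 0 ≤ potential d β y :=
  setIntegral_nonneg measurableSet_Ioi fun _ hu =>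
    mul_nonneg (Real.exp_pos _).le (heatKernel_nonneg (le_of_lt hu) _ _)

theorem potential_antitone {d : ℕ} (hd : 1 ≤ d) {β β' : ℝ} (hβ : 0 < β) (h : β ≤ β') {y : Space d}
    (hy : 1 ≤ ‖y‖) : potential d β' y ≤ potential d β y := by
  refine setIntegral_mono_on (integrableOn_potential hd (hβ.trans_le h) hy)
    (integrableOn_potential hd hβ hy) measurableSet_Ioi fun u hu => ?_
  have hu : 0 < u := hu
  have := heatKernel_nonneg hu.le 0 y
  gcongr

theorem potential_one_eq {d : ℕ} (y : Space d) :
    potential d 1 y = (4 * Real.pi) ^ (-(d : ℝ) / 2) * besselIntegral (d / 2) ‖y‖ := by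
  rw [potential, besselIntegral, ← integral_const_mul]
  refine setIntegral_congr_fun measurableSet_Ioi fun u hu => ?_
  simp only [heatKernel_eq (Set.mem_Ioi.1 hu), sub_eq_add_neg, Real.exp_add, neg_div, neg_one_mul]
  ring

theorem exists_potential_le {d : ℕ} (hd : 1 ≤ d) {β γ : ℝ} (hβ : γ ^ 2 < β) :
    ∃ K : ℝ, 0 < K ∧ ∀ y : Space d, 1 ≤ ‖y‖ → potential d β y ≤ K * Real.exp (-γ * ‖y‖) := by
  have hβ0 : 0 < β := (sq_nonneg γ).trans_lt hβ
  obtain ⟨K, ε, hK, hε, h⟩ :=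
    exists_pointwise_exp_bound (show (0 : ℝ) < d / 2 by positivity) hβ
  have hpi := Real.pi_pos
  refine ⟨(4 * Real.pi) ^ (-(d : ℝ) / 2) * K * (1 / ε), by positivity, fun y hy => ?_⟩
  have hint : ∫ u in Set.Ioi (0 : ℝ), Real.exp (-ε * u) = 1 / ε := by
    rw [integral_exp_mul_Ioi (neg_lt_zero.2 hε)]; simp
  calc potential d β y
      ≤ ∫ u in Set.Ioi (0 : ℝ), (4 * Real.pi) ^ (-(d : ℝ) / 2) * (K * Real.exp (-γ * ‖y‖)) *
          Real.exp (-ε * u) := by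
        refine setIntegral_mono_on (integrableOn_potential hd hβ0 hy)
          ((integrableOn_exp_mul_Ioi (neg_lt_zero.2 hε) 0).const_mul _) measurableSet_Ioi
          fun u hu => ?_
        rw [heatKernel_eq (Set.mem_Ioi.1 hu), mul_left_comm, mul_assoc]
        exact mul_le_mul_of_nonneg_left (h _ u hy hu) (by positivity)
    _ = _ := by rw [integral_const_mul, hint]; ring

/-! ### q-Pochhammer symbols and the series for the ergodic density -/

section qPochhammer

variable {m : ℝ}

theorem one_sub_mul_pow_mem (hm0 : 0 < m) (hm1 : m < 1) (j : ℕ) :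
    0 < 1 - m * m ^ j ∧ 1 - m * m ^ j ≤ 1 := by
  have h1 : m * m ^ j < 1 := by
    rw [← pow_succ']; exact pow_lt_one₀ hm0.le hm1 (by simp)
  have h2 : 0 < m * m ^ j := by positivity
  constructor <;> linarith

theorem qPochhammer_pos (hm0 : 0 < m) (hm1 : m < 1) (n : ℕ) : 0 < qPochhammer m m n :=
  Finset.prod_pos fun j _ => (one_sub_mul_pow_mem hm0 hm1 j).1

theorem qPochhammer_succ (n : ℕ) :
    qPochhammer m m (n + 1) = qPochhammer m m n * (1 - m * m ^ n) := Finset.prod_range_succ _ _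

theorem qPochhammer_antitone (hm0 : 0 < m) (hm1 : m < 1) : Antitone (qPochhammer m m) :=
  antitone_nat_of_succ_le fun n => by
    rw [qPochhammer_succ]
    exact mul_le_of_le_one_right (qPochhammer_pos hm0 hm1 n).le (one_sub_mul_pow_mem hm0 hm1 n).2

theorem tendsto_qPochhammer (hm0 : 0 < m) (hm1 : m < 1) :
    Tendsto (qPochhammer m m) atTop (𝓝 (qPochhammerInf m m)) := by
  have hs : Summable fun j : ℕ => ‖-(m * m ^ j)‖ := by
    simp only [norm_neg]
    exact ((summable_geometric_of_lt_one hm0.le hm1).mul_left m).norm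
  have h := (multipliable_one_add_of_summable hs).hasProd.tendsto_prod_nat
  simp only [← sub_eq_add_neg] at h
  exact h

/-- The partial products decrease, so the factor number `n + j` removes at most `m^(n+1+j) (m;
m)_n`. These losses form a geometric sum. -/
theorem qPochhammer_add_ge (hm0 : 0 < m) (hm1 : m < 1) (n k : ℕ) :
    qPochhammer m m n * (1 - m ^ (n + 1) * ((1 - m ^ k) / (1 - m))) ≤ qPochhammer m m (n + k) := by
  have h1m : 0 < 1 - m := sub_pos.2 hm1
  induction k with
  | zero => simp
  | succ k ih =>
    rw [← add_assoc, qPochhammer_succ]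
    have hx : 0 < m ^ (n + 1) * m ^ k := by positivity
    have hle : qPochhammer m m (n + k) ≤ qPochhammer m m n :=
      qPochhammer_antitone hm0 hm1 (Nat.le_add_right n k)
    have e1 : m * m ^ (n + k) = m ^ (n + 1) * m ^ k := by ring
    have e2 : m ^ (n + 1) * ((1 - m ^ (k + 1)) / (1 - m))
        = m ^ (n + 1) * ((1 - m ^ k) / (1 - m)) + m ^ (n + 1) * m ^ k := by
      field_simp; ring
    rw [e1, e2]
    nlinarith [mul_le_mul_of_nonneg_right hle hx.le]

theorem qPochhammerInf_ge (hm0 : 0 < m) (hm1 : m < 1) (n : ℕ) :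
    qPochhammer m m n * (1 - m ^ (n + 1) / (1 - m)) ≤ qPochhammerInf m m := by
  have h1m : 0 < 1 - m := sub_pos.2 hm1
  have h1 : Tendsto (fun k => qPochhammer m m (n + k)) atTop (𝓝 (qPochhammerInf m m)) := by
    simpa only [add_comm n] using (tendsto_add_atTop_iff_nat n).2 (tendsto_qPochhammer hm0 hm1)
  refine ge_of_tendsto' h1 fun k => le_trans ?_ (qPochhammer_add_ge hm0 hm1 n k)
  refine mul_le_mul_of_nonneg_left ?_ (qPochhammer_pos hm0 hm1 n).le
  have : 0 < m ^ k := by positivity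
  rw [← mul_div_assoc]
  have : m ^ (n + 1) * (1 - m ^ k) / (1 - m) ≤ m ^ (n + 1) / (1 - m) := by
    gcongr
    exact mul_le_of_le_one_right (by positivity) (by linarith)
  linarith

theorem qPochhammerInf_le (hm0 : 0 < m) (hm1 : m < 1) (n : ℕ) :
    qPochhammerInf m m ≤ qPochhammer m m n :=
  (qPochhammer_antitone hm0 hm1).le_of_tendsto (tendsto_qPochhammer hm0 hm1) n

theorem qPochhammerInf_pos (hm0 : 0 < m) (hm1 : m < 1) : 0 < qPochhammerInf m m := by
  have h1m : 0 < 1 - m := sub_pos.2 hm1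
  obtain ⟨n, hn⟩ := exists_pow_lt_of_lt_one h1m hm1
  refine lt_of_lt_of_le (mul_pos (qPochhammer_pos hm0 hm1 n) ?_) (qPochhammerInf_ge hm0 hm1 n)
  rw [sub_pos, div_lt_one h1m, pow_succ]
  exact (mul_le_of_le_one_right (by positivity) hm1.le).trans_lt hn

end qPochhammer

/-- Only `k = 0` matters: every later potential kernel has rate at least `m⁻¹` and is dominated by
the one at `m⁻¹`, while the coefficients decay geometrically. -/
theorem abs_rho_sub_le {d : ℕ} (hd : 1 ≤ d) {m : ℝ} (hm0 : 0 < m) (hm1 : m < 1) {y : Space d}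
    (hy : 1 ≤ ‖y‖) :
    |rho d m y - 1 / qPochhammerInf m m * potential d 1 y|
      ≤ 1 / qPochhammerInf m m * (1 / qPochhammerInf m m / (1 - m) * potential d m⁻¹ y) := by
  have hZ := qPochhammerInf_pos hm0 hm1
  set Z := qPochhammerInf m m
  set f : ℕ → ℝ := fun k =>
    (-1) ^ k * (m ^ (k.choose 2) / qPochhammer m m k) * potential d (m ^ k)⁻¹ y with hf
  have hbound : ∀ k, ‖f (k + 1)‖ ≤ m ^ k * (1 / Z * potential d m⁻¹ y) := by
    intro k
    have hq := qPochhammer_pos hm0 hm1 (k + 1)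
    have hp := potential_nonneg d (m ^ (k + 1))⁻¹ y
    rw [Real.norm_eq_abs, hf, abs_mul, abs_mul, abs_pow, abs_neg, abs_one, one_pow, one_mul,
      abs_of_nonneg hp, abs_of_pos (by positivity), ← mul_assoc]
    -- Here `(k+1).choose 2 = k + k.choose 2`.
    have h1 : m ^ ((k + 1).choose 2) ≤ m ^ k := by
      refine pow_le_pow_of_le_one hm0.le hm1.le ?_
      rw [Nat.choose_succ_succ' k 1, Nat.choose_one_right]
      exact Nat.le_add_right _ _
    have h2 : potential d (m ^ (k + 1))⁻¹ y ≤ potential d m⁻¹ y := by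
      refine potential_antitone hd (inv_pos.2 hm0) (inv_anti₀ (by positivity) ?_) hy
      exact pow_le_of_le_one hm0.le hm1.le (by simp)
    have h3 : m ^ ((k + 1).choose 2) / qPochhammer m m (k + 1) ≤ m ^ k * (1 / Z) := by
      rw [← div_eq_mul_one_div]
      exact div_le_div₀ (by positivity) h1 hZ (qPochhammerInf_le hm0 hm1 _)
    exact mul_le_mul h3 h2 hp (by positivity)
  have hgeo := (summable_geometric_of_lt_one hm0.le hm1).mul_right (1 / Z * potential d m⁻¹ y)
  have hsum1 : Summable fun k => f (k + 1) := Summable.of_norm_bounded hgeo hbound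
  have hsum : Summable f := (summable_nat_add_iff 1).1 hsum1
  have h0 : f 0 = potential d 1 y := by simp [hf, qPochhammer]
  rw [rho, hsum.tsum_eq_zero_add, h0, ← mul_sub, add_sub_cancel_left, abs_mul,
    abs_of_pos (by positivity)]
  gcongr
  refine (tsum_of_norm_bounded hgeo.hasSum hbound).trans_eq ?_
  rw [tsum_mul_right, tsum_geometric_of_lt_one hm0.le hm1]
  ring

/-! ### Integration over the positive orthant -/

/-- Lebesgue measure on the positive orthant of `ℝ^n`. -/
def orthant (n : ℕ) : Measure (Fin n → ℝ) := Measure.pi fun _ => volume.restrict (Set.Ioi 0)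

theorem lintegral_pi_insertNth {n : ℕ} (μ : Measure ℝ) [SigmaFinite μ] (i : Fin (n + 1))
    {F : (Fin (n + 1) → ℝ) → ℝ≥0∞} (hF : Measurable F) :
    ∫⁻ w, F w ∂(Measure.pi fun _ => μ)
      = ∫⁻ x, ∫⁻ v, F (i.insertNth x v) ∂(Measure.pi fun _ : Fin n => μ) ∂μ := by
  have h := (measurePreserving_piFinSuccAbove (fun _ : Fin (n + 1) => μ) i).symm
  rw [← h.lintegral_comp hF]
  exact lintegral_prod _ (hF.comp h.measurable).aemeasurable

theorem lintegral_orthant_succ {n : ℕ} (i : Fin (n + 1)) {F : (Fin (n + 1) → ℝ) → ℝ≥0∞}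
    (hF : Measurable F) : ∫⁻ w, F w ∂(orthant (n + 1))
      = ∫⁻ x in Set.Ioi 0, ∫⁻ v, F (i.insertNth x v) ∂(orthant n) :=
  lintegral_pi_insertNth _ i hF

instance sigmaFinite_orthant (n : ℕ) : SigmaFinite (orthant n) := by unfold orthant; infer_instance

theorem ae_orthant_pos (n : ℕ) : ∀ᵐ w ∂(orthant n), ∀ i, 0 < w i := by
  rw [orthant, ← Measure.restrict_pi_pi]
  filter_upwards [ae_restrict_mem (MeasurableSet.univ_pi fun _ => measurableSet_Ioi)] with w hw i
  exact hw i (Set.mem_univ i)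

theorem lintegral_orthant_zero (F : (Fin 0 → ℝ) → ℝ≥0∞) (hF : Measurable F) :
    ∫⁻ w, F w ∂(orthant 0) = F 0 := by
  rw [orthant, Measure.pi_of_empty, lintegral_dirac' _ hF]
  congr 1
  exact Subsingleton.elim _ _

theorem lintegral_Ioi_comp_mul_left {κ : ℝ} (hκ : 0 < κ) (f : ℝ → ℝ≥0∞) (hf : Measurable f) :
    ENNReal.ofReal κ * ∫⁻ x in Set.Ioi 0, f (κ * x) = ∫⁻ x in Set.Ioi 0, f x := by
  conv_rhs => rw [← Real.smul_map_volume_mul_left hκ.ne', Measure.restrict_smul, lintegral_smul_measure,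
    abs_of_pos hκ, ← lintegral_indicator measurableSet_Ioi,
    lintegral_map (hf.indicator measurableSet_Ioi) (measurable_const_mul κ)]
  rw [smul_eq_mul, ← lintegral_indicator measurableSet_Ioi]
  congr 2 with x
  simp [Set.indicator, hκ]

theorem lintegral_orthant_comp_mul {n : ℕ} {κ : Fin n → ℝ} (hκ : ∀ i, 0 < κ i)
    {F : (Fin n → ℝ) → ℝ≥0∞} (hF : Measurable F) :
    ENNReal.ofReal (∏ i, κ i) * ∫⁻ w, F (fun i => κ i * w i) ∂(orthant n)
      = ∫⁻ w, F w ∂(orthant n) := by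
  induction n with
  | zero =>
    rw [lintegral_orthant_zero _ (by fun_prop), lintegral_orthant_zero _ hF]
    simp only [Finset.univ_eq_empty, Finset.prod_empty, ENNReal.ofReal_one, one_mul]
    congr 1
    exact Subsingleton.elim _ _
  | succ n ih =>
    have hins : ∀ (x : ℝ) (v : Fin n → ℝ), (fun i => κ i * (Fin.insertNth 0 x v : Fin (n + 1) → ℝ) i)
        = Fin.insertNth 0 (κ 0 * x) (fun i => κ i.succ * v i) := by
      intro x v
      ext i
      refine Fin.cases ?_ (fun j => ?_) i <;> simp
    have hmeas : Measurable fun p : ℝ × (Fin n → ℝ) =>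
        F (Fin.insertNth (α := fun _ => ℝ) 0 p.1 p.2) :=
      hF.comp (MeasurableEquiv.piFinSuccAbove (fun _ => ℝ) 0).symm.measurable
    rw [lintegral_orthant_succ 0 (by fun_prop), lintegral_orthant_succ 0 hF, Fin.prod_univ_succ,
      ENNReal.ofReal_mul (hκ 0).le, mul_assoc]
    simp only [hins]
    rw [← lintegral_const_mul' _ _ ENNReal.ofReal_ne_top]
    have : ∀ x : ℝ, ENNReal.ofReal (∏ i : Fin n, κ i.succ) *
        ∫⁻ v, F (Fin.insertNth 0 (κ 0 * x) fun i => κ i.succ * v i) ∂(orthant n)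
        = ∫⁻ v, F (Fin.insertNth 0 (κ 0 * x) v) ∂(orthant n) := fun x =>
      ih (κ := fun i => κ i.succ) (F := fun v => F (Fin.insertNth 0 (κ 0 * x) v))
        (fun i => hκ i.succ) (hmeas.comp measurable_prodMk_left)
    simp only [this]
    exact lintegral_Ioi_comp_mul_left (hκ 0)
      (fun x => ∫⁻ v, F (Fin.insertNth 0 x v) ∂(orthant n)) hmeas.lintegral_prod_right'

theorem lintegral_Ioo_pow_div_factorial {r : ℝ} (hr : 0 ≤ r) (n : ℕ) :
    ∫⁻ x in Set.Ioo 0 r, ENNReal.ofReal ((r - x) ^ n / n.factorial)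
      = ENNReal.ofReal (r ^ (n + 1) / (n + 1).factorial) := by
  have hcont : Continuous fun x : ℝ => (r - x) ^ n / (n.factorial : ℝ) := by fun_prop
  rw [← ofReal_integral_eq_lintegral_ofReal, ← integral_Ioc_eq_integral_Ioo,
    ← intervalIntegral.integral_of_le hr, intervalIntegral.integral_comp_sub_left
      (fun x => x ^ n / (n.factorial : ℝ)) r, intervalIntegral.integral_div, integral_pow]
  · congr 1
    rw [Nat.factorial_succ]
    push_cast
    simp only [sub_self, sub_zero]
    field_simp
    simp
  · exact (hcont.integrableOn_Icc).mono_set Set.Ioo_subset_Icc_self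
  · filter_upwards [ae_restrict_mem measurableSet_Ioo] with x hx
    have : 0 ≤ r - x := sub_nonneg.2 hx.2.le
    show (0 : ℝ) ≤ _
    positivity

/-- Convolving `s^n / n!` with the indicator of `(0, ∞)` raises `n` by one; this drives the
induction for the law of the coordinate sum. -/
theorem lintegral_lintegral_add_pow (n : ℕ) {F : ℝ → ℝ≥0∞} (hF : Measurable F) :
    ∫⁻ x in Set.Ioi 0, ∫⁻ s in Set.Ioi 0, ENNReal.ofReal (s ^ n / n.factorial) * F (x + s)
      = ∫⁻ s in Set.Ioi 0, ENNReal.ofReal (s ^ (n + 1) / (n + 1).factorial) * F s := by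
  have hshift : ∀ x : ℝ, ∫⁻ s in Set.Ioi 0, ENNReal.ofReal (s ^ n / n.factorial) * F (x + s)
      = ∫⁻ r, (Set.Ioi x).indicator
        (fun r => ENNReal.ofReal ((r - x) ^ n / n.factorial) * F r) r := by
    intro x
    rw [← lintegral_indicator measurableSet_Ioi,
      ← lintegral_add_right_eq_self (fun r => (Set.Ioi x).indicator _ r) x]
    congr 1 with s
    simp only [Set.indicator, Set.mem_Ioi, add_sub_cancel_right, add_comm x s,
      lt_add_iff_pos_left]
  simp only [hshift]
  rw [← lintegral_indicator measurableSet_Ioi]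
  have hind : ∀ x : ℝ, (Set.Ioi (0 : ℝ)).indicator (fun x => ∫⁻ r, (Set.Ioi x).indicator
        (fun r => ENNReal.ofReal ((r - x) ^ n / n.factorial) * F r) r) x
      = ∫⁻ r, (if 0 < x ∧ x < r then
          ENNReal.ofReal ((r - x) ^ n / n.factorial) * F r else 0) := by
    intro x
    by_cases hx : 0 < x <;> simp [Set.indicator, hx]
  simp only [hind]
  rw [lintegral_lintegral_swap, ← lintegral_indicator measurableSet_Ioi]
  · congr 1 with r
    by_cases hr : 0 < r
    · rw [Set.indicator_of_mem (Set.mem_Ioi.2 hr), ← lintegral_Ioo_pow_div_factorial hr.le,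
        ← lintegral_mul_const _ (by fun_prop), ← lintegral_indicator measurableSet_Ioo]
      simp only [Set.indicator, Set.mem_Ioo]
    · rw [Set.indicator_of_notMem (by simpa using hr)]
      refine lintegral_eq_zero_of_ae_eq_zero (ae_of_all _ fun x => ?_)
      simp only [Pi.zero_apply, ite_eq_right_iff]
      rintro ⟨h1, h2⟩
      exact absurd (h1.trans h2) hr
  · refine Measurable.aemeasurable (Measurable.ite ?_ (by fun_prop) measurable_const)
    exact (measurableSet_lt measurable_const measurable_fst).inter
      (measurableSet_lt measurable_fst measurable_snd)

theorem sum_insertNth {n : ℕ} (i : Fin (n + 1)) (x : ℝ) (v : Fin n → ℝ) :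
    ∑ j, (i.insertNth x v : Fin (n + 1) → ℝ) j = x + ∑ j, v j := by
  rw [Fin.sum_univ_succAbove _ i]; simp

/-- The sum of the coordinates maps Lebesgue measure on the positive orthant of `ℝ^{n+1}` to
`s^n / n! ds`. -/
theorem lintegral_orthant_sum (n : ℕ) {F : ℝ → ℝ≥0∞} (hF : Measurable F) :
    ∫⁻ v, F (∑ i, v i) ∂(orthant (n + 1))
      = ∫⁻ s in Set.Ioi 0, ENNReal.ofReal (s ^ n / n.factorial) * F s := by
  induction n generalizing F with
  | zero =>
    rw [lintegral_orthant_succ 0 (by fun_prop)]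
    refine lintegral_congr fun x => ?_
    rw [lintegral_orthant_zero _ (by
      simp only [sum_insertNth]; fun_prop)]
    simp
  | succ n ih =>
    rw [lintegral_orthant_succ 0 (by fun_prop), ← lintegral_lintegral_add_pow n hF]
    refine lintegral_congr fun x => ?_
    simp only [sum_insertNth]
    exact ih (F := fun s => F (x + s)) (by fun_prop)

/-- By symmetry all coordinates give the same integral. Together they give the integral of `s F(s)`
against `s^n / n!`, so each one contributes a fraction `1/(n+1)`. -/
theorem lintegral_orthant_coord (n : ℕ) (i : Fin (n + 1)) {F : ℝ → ℝ≥0∞} (hF : Measurable F) :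
    ∫⁻ v, ENNReal.ofReal (v i) * F (∑ j, v j) ∂(orthant (n + 1))
      = ∫⁻ s in Set.Ioi 0, ENNReal.ofReal (s ^ (n + 1) / (n + 1).factorial) * F s := by
  set V := ∫⁻ x in Set.Ioi 0, ∫⁻ v, ENNReal.ofReal x * F (x + ∑ j, v j) ∂(orthant n) with hV
  have hi : ∀ i : Fin (n + 1),
      ∫⁻ v, ENNReal.ofReal (v i) * F (∑ j, v j) ∂(orthant (n + 1)) = V := by
    intro i
    rw [lintegral_orthant_succ i (by fun_prop)]
    simp only [sum_insertNth, Fin.insertNth_apply_same, hV]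
  have hsum : ((n + 1 : ℕ) : ℝ≥0∞) * V
      = ∫⁻ v, ENNReal.ofReal (∑ j, v j) * F (∑ j, v j) ∂(orthant (n + 1)) := by
    have h1 : ∑ i : Fin (n + 1), ∫⁻ v, ENNReal.ofReal (v i) * F (∑ j, v j) ∂(orthant (n + 1))
        = ((n + 1 : ℕ) : ℝ≥0∞) * V := by
      simp [hi]
    rw [← h1, ← lintegral_finsetSum _ (fun i _ => by fun_prop)]
    refine lintegral_congr_ae ?_
    filter_upwards [ae_orthant_pos (n + 1)] with v hv
    rw [ENNReal.ofReal_sum_of_nonneg fun i _ => (hv i).le, Finset.sum_mul]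
  rw [lintegral_orthant_sum n (F := fun s => ENNReal.ofReal s * F s) (by fun_prop)] at hsum
  have hne : ((n + 1 : ℕ) : ℝ≥0∞) ≠ 0 := by simp
  rw [hi, ← ENNReal.mul_right_inj hne (ENNReal.natCast_ne_top _), hsum,
    ← lintegral_const_mul' _ _ (ENNReal.natCast_ne_top _)]
  refine setLIntegral_congr_fun measurableSet_Ioi fun s hs => ?_
  have hs : 0 < s := hs
  simp only [← mul_assoc]
  congr 1
  rw [← ENNReal.ofReal_natCast (n + 1), ← ENNReal.ofReal_mul (by positivity),
    ← ENNReal.ofReal_mul (by positivity), Nat.factorial_succ]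
  congr 1
  push_cast
  field_simp
  ring

/-! ### Law of the variance parameter and its two-sided bounds -/

/-- The variance parameter of the reset process at time `t`, in terms of the waiting times `w`
between the successive resets before `t`, listed backwards in time. -/
def clock (m t : ℝ) {n : ℕ} (w : Fin n → ℝ) : ℝ := t - ∑ i : Fin n, (1 - m ^ ((i : ℕ) + 1)) * w i

theorem measurable_clock (m t : ℝ) (n : ℕ) : Measurable (clock m t : (Fin n → ℝ) → ℝ) := by
  unfold clock; fun_prop

/-- The law of the variance parameter of the reset process at time `t`. -/
def clockLaw (m t : ℝ) : Measure ℝ := Measure.sum fun n : ℕ =>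
  ENNReal.ofReal (Real.exp (-t)) •
    (((orthant n).restrict {w | ∑ i, w i ≤ t}).map (clock m t))

theorem measurableSet_sum_le (n : ℕ) (t : ℝ) : MeasurableSet {w : Fin n → ℝ | ∑ i, w i ≤ t} :=
  measurableSet_le (by fun_prop) measurable_const

theorem lintegral_clockLaw (m t : ℝ) {φ : ℝ → ℝ≥0∞} (hφ : Measurable φ) :
    ∫⁻ u, φ u ∂(clockLaw m t) = ∑' n : ℕ, ENNReal.ofReal (Real.exp (-t)) *
      ∫⁻ w in {w | ∑ i, w i ≤ t}, φ (clock m t w) ∂(orthant n) := by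
  rw [clockLaw, lintegral_sum_measure]
  refine tsum_congr fun n => ?_
  rw [lintegral_smul_measure, lintegral_map hφ (measurable_clock m t n), smul_eq_mul]

section Bounds

variable {m : ℝ}

theorem prod_one_sub_pow_eq (n : ℕ) :
    ∏ i : Fin n, (1 - m ^ ((i : ℕ) + 1)) = qPochhammer m m n := by
  rw [qPochhammer, ← Fin.prod_univ_eq_prod_range (fun j => 1 - m * m ^ j)]
  simp only [pow_succ']

theorem one_sub_pow_succ_mem (hm0 : 0 < m) (hm1 : m < 1) (j : ℕ) :
    0 < 1 - m ^ (j + 1) ∧ 1 - m ^ (j + 1) < 1 := by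
  have h := one_sub_mul_pow_mem hm0 hm1 j
  rw [← pow_succ'] at h
  exact ⟨h.1, by have : 0 < m ^ (j + 1) := by positivity
                 linarith⟩

theorem sum_one_sub_pow_mul_lt (hm0 : 0 < m) (hm1 : m < 1) {n : ℕ} {w : Fin (n + 1) → ℝ}
    (hw : ∀ i, 0 < w i) : ∑ i : Fin (n + 1), (1 - m ^ ((i : ℕ) + 1)) * w i < ∑ i, w i :=
  Finset.sum_lt_sum_of_nonempty Finset.univ_nonempty fun i _ =>
    mul_lt_of_lt_one_left (hw i) (one_sub_pow_succ_mem hm0 hm1 i).2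

/-- The integral of `φ (t - ·)` over `(0, t)` against `s^n / n! ds`. -/
def powIntegral (t : ℝ) (n : ℕ) (φ : ℝ → ℝ≥0∞) : ℝ≥0∞ :=
  ∫⁻ s in Set.Ioi 0, ENNReal.ofReal (s ^ n / n.factorial) * (Set.Iio t).indicator (fun s => φ (t - s)) s

/-- The exponential series, after the substitution `u = t - s`. The value `b = 1` gives the main
term, and `b = m` the cost of replacing `(m; m)_n` by its limit. -/
theorem tsum_powIntegral (t b : ℝ) (hb : 0 ≤ b) {φ : ℝ → ℝ≥0∞} (hφ : Measurable φ) :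
    ∑' n : ℕ, ENNReal.ofReal (b ^ n) * powIntegral t n φ
      = ∫⁻ u in Set.Ioo 0 t, ENNReal.ofReal (Real.exp (b * (t - u))) * φ u := by
  have hH : Measurable ((Set.Iio t).indicator (fun s => φ (t - s))) :=
    Measurable.indicator (by fun_prop) measurableSet_Iio
  have h1 : ∀ n : ℕ, ENNReal.ofReal (b ^ n) * powIntegral t n φ
      = ∫⁻ s in Set.Ioi 0, ENNReal.ofReal ((b * s) ^ n / n.factorial) *
          (Set.Iio t).indicator (fun s => φ (t - s)) s := by
    intro n
    rw [powIntegral, ← lintegral_const_mul' _ _ ENNReal.ofReal_ne_top]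
    congr 1 with s
    rw [← mul_assoc, ← ENNReal.ofReal_mul (by positivity), mul_pow, mul_div_assoc]
  simp only [h1]
  rw [← lintegral_tsum fun n => (by fun_prop)]
  have h2 : ∀ s ∈ Set.Ioi (0 : ℝ), ∑' n : ℕ, ENNReal.ofReal ((b * s) ^ n / n.factorial) *
          (Set.Iio t).indicator (fun s => φ (t - s)) s
      = ENNReal.ofReal (Real.exp (b * s)) * (Set.Iio t).indicator (fun s => φ (t - s)) s := by
    intro s hs
    have hs : 0 < s := hs
    rw [ENNReal.tsum_mul_right, ← ENNReal.ofReal_tsum_of_nonneg (fun n => by positivity)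
      (Real.summable_pow_div_factorial _), Real.exp_eq_exp_ℝ, NormedSpace.exp_eq_tsum_div]
  rw [setLIntegral_congr_fun measurableSet_Ioi h2, ← lintegral_indicator measurableSet_Ioi,
    ← lintegral_indicator measurableSet_Ioo,
    ← lintegral_sub_left_eq_self (fun u => (Set.Ioo 0 t).indicator _ u) t]
  congr 1 with s
  by_cases h1 : 0 < s <;> by_cases h2 : s < t <;> simp [Set.indicator, h1, h2]

theorem ofReal_qPochhammer_mul_lintegral (hm0 : 0 < m) (hm1 : m < 1) (n : ℕ)
    {F : (Fin n → ℝ) → ℝ≥0∞} (hF : Measurable F) :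
    ENNReal.ofReal (qPochhammer m m n) *
      ∫⁻ w, F (fun i => (1 - m ^ ((i : ℕ) + 1)) * w i) ∂(orthant n) = ∫⁻ w, F w ∂(orthant n) := by
  rw [← prod_one_sub_pow_eq]
  exact lintegral_orthant_comp_mul (fun i => (one_sub_pow_succ_mem hm0 hm1 i).1) hF

theorem ofReal_mul_ofReal_one_div {x : ℝ} (hx : 0 < x) (y : ℝ≥0∞) :
    ENNReal.ofReal (1 / x) * (ENNReal.ofReal x * y) = y := by
  rw [← mul_assoc, ← ENNReal.ofReal_mul (by positivity), one_div_mul_cancel hx.ne',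
    ENNReal.ofReal_one, one_mul]

/-- The rescaling `v i = (1 - m^(i+1)) w i` turns `clock` into `t - ∑ v i` with Jacobian `1 / (m;
m)_(n+1)`. The constraint `∑ w i ≤ t` is then relaxed to the weaker `∑ v i < t`. -/
theorem lintegral_clock_le (hm0 : 0 < m) (hm1 : m < 1) (t : ℝ) (n : ℕ) {φ : ℝ → ℝ≥0∞}
    (hφ : Measurable φ) :
    ∫⁻ w in {w | ∑ i, w i ≤ t}, φ (clock m t w) ∂(orthant (n + 1))
      ≤ ENNReal.ofReal (1 / qPochhammerInf m m) * powIntegral t n φ := by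
  have hH : Measurable ((Set.Iio t).indicator (fun s => φ (t - s))) :=
    Measurable.indicator (by fun_prop) measurableSet_Iio
  have hQ := qPochhammer_pos hm0 hm1 (n + 1)
  have h1 : ∫⁻ w in {w | ∑ i, w i ≤ t}, φ (clock m t w) ∂(orthant (n + 1))
      ≤ ∫⁻ w, (Set.Iio t).indicator (fun s => φ (t - s))
          (∑ i : Fin (n + 1), (1 - m ^ ((i : ℕ) + 1)) * w i) ∂(orthant (n + 1)) := by
    rw [← lintegral_indicator (measurableSet_sum_le _ t)]
    refine lintegral_mono_ae ?_
    filter_upwards [ae_orthant_pos (n + 1)] with w hw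
    by_cases ht : ∑ i, w i ≤ t
    · rw [Set.indicator_of_mem (by exact ht), Set.indicator_of_mem (by
        exact (sum_one_sub_pow_mul_lt hm0 hm1 hw).trans_le ht)]
      rfl
    · rw [Set.indicator_of_notMem (by exact ht)]
      exact zero_le
  refine h1.trans ?_
  have h2 := ofReal_qPochhammer_mul_lintegral hm0 hm1 (n + 1)
    (F := fun v => (Set.Iio t).indicator (fun s => φ (t - s)) (∑ i, v i)) (by fun_prop)
  rw [lintegral_orthant_sum n hH] at h2
  rw [powIntegral, ← h2]
  refine (ofReal_mul_ofReal_one_div hQ _).symm.le.trans ?_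
  gcongr
  exacts [qPochhammerInf_pos hm0 hm1, qPochhammerInf_le hm0 hm1 _]

theorem sum_pow_div_le (hm0 : 0 < m) (hm1 : m < 1) (n : ℕ) :
    ∑ i : Fin n, m ^ ((i : ℕ) + 1) / (1 - m) ≤ m / (1 - m) ^ 2 := by
  have h1m : 0 < 1 - m := sub_pos.2 hm1
  rw [Fin.sum_univ_eq_sum_range (fun j => m ^ (j + 1) / (1 - m)) n, ← Finset.sum_div]
  simp only [pow_succ' m]
  rw [← Finset.mul_sum, sq, ← div_div]
  gcongr
  rw [div_eq_mul_inv]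
  gcongr
  rw [← tsum_geometric_of_lt_one hm0.le hm1]
  exact (summable_geometric_of_lt_one hm0.le hm1).sum_le_tsum _ fun _ _ => by positivity

/-- Converse to the relaxed bound. The relaxation adds the points with `∑ v i < t < ∑ v i / κ i`,
where `t - ∑ v i ≤ ∑ l i v i`. Their indicator is at most `∑ l i v i / (t - ∑ v i)`, and the
integrals with weight `v i` are given by `lintegral_orthant_coord`. -/
theorem powIntegral_le_add (hm0 : 0 < m) (hm1 : m < 1) (t : ℝ) (n : ℕ) {φ : ℝ → ℝ≥0∞}
    (hφ : Measurable φ) :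
    powIntegral t n φ ≤ ENNReal.ofReal (qPochhammer m m (n + 1)) *
        ∫⁻ w in {w | ∑ i, w i ≤ t}, φ (clock m t w) ∂(orthant (n + 1)) +
      ENNReal.ofReal (m / (1 - m) ^ 2) *
        powIntegral t (n + 1) (fun u => ENNReal.ofReal u⁻¹ * φ u) := by
  have h1m : 0 < 1 - m := sub_pos.2 hm1
  set H := (Set.Iio t).indicator (fun s => φ (t - s)) with hHdef
  have hH : Measurable H := Measurable.indicator (by fun_prop) measurableSet_Iio
  set H' := (Set.Iio t).indicator (fun s => ENNReal.ofReal (t - s)⁻¹ * φ (t - s)) with hH'def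
  have hH' : Measurable H' := Measurable.indicator (by fun_prop) measurableSet_Iio
  set κ : Fin (n + 1) → ℝ := fun i => 1 - m ^ ((i : ℕ) + 1) with hκ
  have hκ0 : ∀ i, 0 < κ i := fun i => (one_sub_pow_succ_mem hm0 hm1 i).1
  set l : Fin (n + 1) → ℝ := fun i => m ^ ((i : ℕ) + 1) / (1 - m) with hl
  have hl0 : ∀ i, 0 ≤ l i := fun i => by positivity
  -- `1/κ i = 1 + m^(i+1) / (1 - m^(i+1))`, and the last denominator is at least `1 - m`.
  have hκl : ∀ i, (κ i)⁻¹ ≤ 1 + l i := by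
    intro i
    have hpow : m ^ ((i : ℕ) + 1) ≤ m := pow_le_of_le_one hm0.le hm1.le (by simp)
    have hp0 : 0 < m ^ ((i : ℕ) + 1) := by positivity
    rw [inv_le_iff_one_le_mul₀ (hκ0 i)]
    simp only [hκ, hl]
    rw [one_add_div h1m.ne', div_mul_eq_mul_div, le_div_iff₀ h1m]
    nlinarith
  set A : Set (Fin (n + 1) → ℝ) := {v | ∑ i, (κ i)⁻¹ * v i ≤ t} with hA
  have hAm : MeasurableSet A := measurableSet_le (by fun_prop) measurable_const
  have hI : ENNReal.ofReal (qPochhammer m m (n + 1)) *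
        ∫⁻ w in {w | ∑ i, w i ≤ t}, φ (clock m t w) ∂(orthant (n + 1))
      = ∫⁻ v, A.indicator (fun v => φ (t - ∑ i, v i)) v ∂(orthant (n + 1)) := by
    rw [← ofReal_qPochhammer_mul_lintegral hm0 hm1 (n + 1)
      (Measurable.indicator (by fun_prop) hAm), ← lintegral_indicator (measurableSet_sum_le _ t)]
    congr 2 with w
    have : ∀ i, (κ i)⁻¹ * ((1 - m ^ ((i : ℕ) + 1)) * w i) = w i := fun i =>
      inv_mul_cancel_left₀ (hκ0 i).ne' _
    simp only [Set.indicator, hA, Set.mem_ofPred_eq, this, clock]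
  have hpt : ∀ᵐ v ∂(orthant (n + 1)), H (∑ i, v i) ≤ A.indicator (fun v => φ (t - ∑ i, v i)) v +
      ∑ i, ENNReal.ofReal (l i) * (ENNReal.ofReal (v i) * H' (∑ j, v j)) := by
    filter_upwards [ae_orthant_pos (n + 1)] with v hv
    by_cases hs : ∑ i, v i < t
    · by_cases hvA : v ∈ A
      · rw [hHdef, Set.indicator_of_mem (by exact hs), Set.indicator_of_mem hvA]
        exact le_self_add
      · have hlt : t < ∑ i, (κ i)⁻¹ * v i := not_le.1 hvA
        have hsum : t - ∑ i, v i ≤ ∑ i, l i * v i := by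
          have : ∑ i, (κ i)⁻¹ * v i ≤ ∑ i, (1 + l i) * v i :=
            Finset.sum_le_sum fun i _ => mul_le_mul_of_nonneg_right (hκl i) (hv i).le
          simp only [add_mul, one_mul, Finset.sum_add_distrib] at this
          linarith
        have hpos : 0 < t - ∑ i, v i := sub_pos.2 hs
        refine le_trans ?_ le_add_self
        rw [hHdef, hH'def, Set.indicator_of_mem (by exact hs), Set.indicator_of_mem (by exact hs)]
        have : ∀ i, ENNReal.ofReal (l i) * (ENNReal.ofReal (v i) *
            (ENNReal.ofReal (t - ∑ j, v j)⁻¹ * φ (t - ∑ j, v j)))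
            = ENNReal.ofReal (l i * v i) * (ENNReal.ofReal (t - ∑ j, v j)⁻¹ * φ (t - ∑ j, v j)) :=
          fun i => by rw [ENNReal.ofReal_mul (hl0 i), mul_assoc]
        simp only [this]
        rw [← Finset.sum_mul, ← ENNReal.ofReal_sum_of_nonneg
          fun i _ => mul_nonneg (hl0 i) (hv i).le, ← mul_assoc, ← ENNReal.ofReal_mul (by
            exact Finset.sum_nonneg fun i _ => mul_nonneg (hl0 i) (hv i).le)]
        -- Markov's inequality pointwise: the ratio `∑ l i v i / (t - ∑ v i)` is at least `1` here.
        refine le_mul_of_one_le_left' ?_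
        rw [ENNReal.one_le_ofReal, ← div_eq_mul_inv, one_le_div hpos]
        exact hsum
    · rw [hHdef, Set.indicator_of_notMem (by exact hs)]
      exact zero_le
  calc powIntegral t n φ = ∫⁻ v, H (∑ i, v i) ∂(orthant (n + 1)) :=
        (lintegral_orthant_sum n hH).symm
    _ ≤ ∫⁻ v, (A.indicator (fun v => φ (t - ∑ i, v i)) v +
          ∑ i, ENNReal.ofReal (l i) * (ENNReal.ofReal (v i) * H' (∑ j, v j))) ∂(orthant (n + 1)) :=
        lintegral_mono_ae hpt
    _ = ∫⁻ v, A.indicator (fun v => φ (t - ∑ i, v i)) v ∂(orthant (n + 1)) +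
          ∑ i, ENNReal.ofReal (l i) * powIntegral t (n + 1) (fun u => ENNReal.ofReal u⁻¹ * φ u) := by
        rw [lintegral_add_left (Measurable.indicator (by fun_prop) hAm),
          lintegral_finsetSum _ (fun i _ => by fun_prop)]
        congr 1
        refine Finset.sum_congr rfl fun i _ => ?_
        rw [lintegral_const_mul' _ _ ENNReal.ofReal_ne_top, lintegral_orthant_coord n i hH']
        rfl
    _ ≤ _ := by
        rw [hI, ← Finset.sum_mul, ← ENNReal.ofReal_sum_of_nonneg fun i _ => hl0 i]
        gcongr
        exact sum_pow_div_le hm0 hm1 (n + 1)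

theorem lintegral_clockLaw_eq_add (m : ℝ) {t : ℝ} (ht : 0 ≤ t) {φ : ℝ → ℝ≥0∞} (hφ : Measurable φ) :
    ∫⁻ u, φ u ∂(clockLaw m t) = ENNReal.ofReal (Real.exp (-t)) * (φ t + ∑' n : ℕ,
      ∫⁻ w in {w | ∑ i, w i ≤ t}, φ (clock m t w) ∂(orthant (n + 1))) := by
  rw [lintegral_clockLaw m t hφ, ENNReal.tsum_mul_left,
    tsum_eq_zero_add' (f := fun n : ℕ =>
      ∫⁻ w in {w | ∑ i, w i ≤ t}, φ (clock m t w) ∂(orthant n)) ENNReal.summable,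
    ← lintegral_indicator (measurableSet_sum_le _ t), lintegral_orthant_zero _
      (Measurable.indicator (f := fun w => φ (clock m t w))
        (hφ.comp (measurable_clock m t 0)) (measurableSet_sum_le _ t))]
  simp [clock, ht]

/-- The law of the variance parameter is at most `e^{-t} δ_t + (m; m)_∞⁻¹ e^{-u} du` on `(0, t]`. -/
theorem lintegral_clockLaw_le (hm0 : 0 < m) (hm1 : m < 1) {t : ℝ} (ht : 0 ≤ t) {φ : ℝ → ℝ≥0∞}
    (hφ : Measurable φ) :
    ∫⁻ u, φ u ∂(clockLaw m t) ≤ ENNReal.ofReal (Real.exp (-t)) * φ t +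
      ENNReal.ofReal (1 / qPochhammerInf m m) *
        ∫⁻ u in Set.Ioo 0 t, ENNReal.ofReal (Real.exp (-u)) * φ u := by
  rw [lintegral_clockLaw_eq_add m ht hφ, mul_add]
  refine add_le_add le_rfl ?_
  have h := tsum_powIntegral t 1 zero_le_one hφ
  simp only [one_pow, ENNReal.ofReal_one, one_mul] at h
  calc ENNReal.ofReal (Real.exp (-t)) * ∑' n : ℕ,
        ∫⁻ w in {w | ∑ i, w i ≤ t}, φ (clock m t w) ∂(orthant (n + 1))
      ≤ ENNReal.ofReal (Real.exp (-t)) * ∑' n : ℕ,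
        ENNReal.ofReal (1 / qPochhammerInf m m) * powIntegral t n φ := by
        gcongr with n
        exact lintegral_clock_le hm0 hm1 t n hφ
    _ = _ := by
        rw [ENNReal.tsum_mul_left, h, mul_left_comm, ← lintegral_const_mul' _ _ ENNReal.ofReal_ne_top]
        congr 2 with u
        rw [← mul_assoc, ← ENNReal.ofReal_mul (Real.exp_pos _).le, ← Real.exp_add,
          neg_add_eq_sub, sub_sub_cancel_left]

/-- The law of the variance parameter is at least `(m; m)_∞⁻¹ e^{-u} du` on `(0, t)`, up to errors
of relative size `1 / u` and `e^{-(1-m)(t-u)}`. -/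
theorem le_lintegral_clockLaw_add (hm0 : 0 < m) (hm1 : m < 1) {t : ℝ} (ht : 0 ≤ t) {φ : ℝ → ℝ≥0∞}
    (hφ : Measurable φ) :
    ENNReal.ofReal (1 / qPochhammerInf m m) *
        ∫⁻ u in Set.Ioo 0 t, ENNReal.ofReal (Real.exp (-u)) * φ u
      ≤ ∫⁻ u, φ u ∂(clockLaw m t) +
        ENNReal.ofReal (1 / qPochhammerInf m m * (m / (1 - m) ^ 2)) *
          (∫⁻ u in Set.Ioo 0 t, ENNReal.ofReal (Real.exp (-u)) * (ENNReal.ofReal u⁻¹ * φ u)) +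
        ENNReal.ofReal (1 / qPochhammerInf m m / (1 - m)) *
          ∫⁻ u in Set.Ioo 0 t, ENNReal.ofReal (Real.exp (-t + m * (t - u))) * φ u := by
  have h1m : 0 < 1 - m := sub_pos.2 hm1
  have hZ := qPochhammerInf_pos hm0 hm1
  set Z := 1 / qPochhammerInf m m with hZdef
  have hZ0 : 0 < Z := by positivity
  set I : ℕ → ℝ≥0∞ := fun n =>
    ∫⁻ w in {w | ∑ i, w i ≤ t}, φ (clock m t w) ∂(orthant (n + 1)) with hI
  have hφ' : Measurable fun u : ℝ => ENNReal.ofReal u⁻¹ * φ u := by fun_prop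
  have hstep : ∀ n : ℕ, ENNReal.ofReal Z * powIntegral t n φ ≤ I n +
      ENNReal.ofReal (Z * (m / (1 - m) ^ 2)) *
        powIntegral t (n + 1) (fun u => ENNReal.ofReal u⁻¹ * φ u) +
      ENNReal.ofReal (Z / (1 - m)) * (ENNReal.ofReal (m ^ n) * powIntegral t n φ) := by
    intro n
    have hQ := qPochhammer_pos hm0 hm1 (n + 1)
    have hQZ : 1 / qPochhammer m m (n + 1) ≤ Z :=
      one_div_le_one_div_of_le hZ (qPochhammerInf_le hm0 hm1 _)
    -- The convergence of `(m; m)_(n+1)` to its limit is geometric by `qPochhammerInf_ge`. The loss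
    -- `m^n` later becomes the factor `e^{m(t-u)}`, in place of `e^{t-u}`.
    have hZQ : ENNReal.ofReal Z ≤ ENNReal.ofReal (1 / qPochhammer m m (n + 1)) +
        ENNReal.ofReal (Z / (1 - m)) * ENNReal.ofReal (m ^ n) := by
      rw [← ENNReal.ofReal_mul (by positivity), ← ENNReal.ofReal_add (by positivity) (by positivity)]
      refine ENNReal.ofReal_le_ofReal ?_
      have h := qPochhammerInf_ge hm0 hm1 (n + 1)
      have hp : m ^ (n + 1 + 1) ≤ m ^ n := pow_le_pow_of_le_one hm0.le hm1.le (by omega)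
      have h' : qPochhammer m m (n + 1) * (1 - m ^ n / (1 - m)) ≤ qPochhammerInf m m := by
        refine le_trans (mul_le_mul_of_nonneg_left ?_ hQ.le) h
        gcongr
      have h2 : Z * (1 - m ^ n / (1 - m)) ≤ 1 / qPochhammer m m (n + 1) := by
        rw [le_div_iff₀ hQ, hZdef, one_div, mul_assoc, inv_mul_le_iff₀ hZ, mul_one, mul_comm]
        exact h'
      have h3 : Z / (1 - m) * m ^ n = Z * (m ^ n / (1 - m)) := by ring
      rw [h3]
      linarith
    have hlow := powIntegral_le_add hm0 hm1 t n hφ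
    calc ENNReal.ofReal Z * powIntegral t n φ
        ≤ (ENNReal.ofReal (1 / qPochhammer m m (n + 1)) +
          ENNReal.ofReal (Z / (1 - m)) * ENNReal.ofReal (m ^ n)) * powIntegral t n φ := by gcongr
      _ = ENNReal.ofReal (1 / qPochhammer m m (n + 1)) * powIntegral t n φ +
          ENNReal.ofReal (Z / (1 - m)) * (ENNReal.ofReal (m ^ n) * powIntegral t n φ) := by
          rw [add_mul, mul_assoc]
      _ ≤ _ := by
          gcongr
          refine (mul_le_mul_right hlow _).trans ?_
          rw [mul_add, ofReal_mul_ofReal_one_div hQ, ← mul_assoc, ← ENNReal.ofReal_mul (by positivity)]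
          gcongr
  have hsum := ENNReal.tsum_le_tsum hstep
  rw [ENNReal.tsum_add, ENNReal.tsum_add, ENNReal.tsum_mul_left, ENNReal.tsum_mul_left,
    ENNReal.tsum_mul_left, tsum_powIntegral t m hm0.le hφ] at hsum
  have e1 := tsum_powIntegral t 1 zero_le_one hφ
  have e2 := tsum_powIntegral t 1 zero_le_one hφ'
  simp only [one_pow, ENNReal.ofReal_one, one_mul] at e1 e2
  -- The index shift only omits the nonnegative term `n = 0` of the exponential series.
  have e3 : ∑' n, powIntegral t (n + 1) (fun u => ENNReal.ofReal u⁻¹ * φ u)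
      ≤ ∫⁻ u in Set.Ioo 0 t, ENNReal.ofReal (Real.exp (t - u)) * (ENNReal.ofReal u⁻¹ * φ u) := by
    rw [← e2, tsum_eq_zero_add' (f := fun n =>
      powIntegral t n (fun u => ENNReal.ofReal u⁻¹ * φ u)) ENNReal.summable]
    exact le_add_self
  rw [e1] at hsum
  have hmul : ∀ (b : ℝ → ℝ) (ψ : ℝ → ℝ≥0∞), ENNReal.ofReal (Real.exp (-t)) *
      ∫⁻ u in Set.Ioo 0 t, ENNReal.ofReal (Real.exp (b u)) * ψ u
      = ∫⁻ u in Set.Ioo 0 t, ENNReal.ofReal (Real.exp (-t + b u)) * ψ u := by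
    intro b ψ
    rw [← lintegral_const_mul' _ _ ENNReal.ofReal_ne_top]
    congr 1 with u
    rw [← mul_assoc, ← ENNReal.ofReal_mul (Real.exp_pos _).le, ← Real.exp_add]
  have hI' : ENNReal.ofReal (Real.exp (-t)) * ∑' n, I n ≤ ∫⁻ u, φ u ∂(clockLaw m t) := by
    rw [lintegral_clockLaw_eq_add m ht hφ]
    gcongr
    exact le_add_self
  have hfin := mul_le_mul_right (hsum.trans (add_le_add_left (add_le_add_right
    (mul_le_mul_right e3 _) _) _)) (ENNReal.ofReal (Real.exp (-t)))
  have hexp : ∀ u : ℝ, -t + (t - u) = -u := fun u => by ring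
  rw [mul_add, mul_add, mul_left_comm, mul_left_comm _ (ENNReal.ofReal (Z * _)),
    mul_left_comm _ (ENNReal.ofReal (Z / _)), hmul, hmul, hmul] at hfin
  simp only [hexp] at hfin
  exact hfin.trans (add_le_add_left (add_le_add_left hI' _) _)

end Bounds

/-! ### Total mass and negative moments of the variance parameter -/

theorem orthant_sum_le {t : ℝ} (ht : 0 ≤ t) (n : ℕ) :
    orthant n {w | ∑ i, w i ≤ t} = ENNReal.ofReal (t ^ n / n.factorial) := by
  rw [← lintegral_indicator_one (measurableSet_sum_le n t)]
  cases n with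
  | zero =>
    rw [lintegral_orthant_zero _ (measurable_one.indicator (measurableSet_sum_le 0 t))]
    simp [ht]
  | succ n =>
    have h := lintegral_orthant_sum n (F := (Set.Iic t).indicator 1)
      (measurable_one.indicator measurableSet_Iic)
    refine (h.trans ?_)
    rw [← lintegral_Ioo_pow_div_factorial ht n, ← lintegral_indicator measurableSet_Ioi,
      ← lintegral_indicator measurableSet_Ioo,
      ← lintegral_sub_left_eq_self (fun u => (Set.Ioi (0 : ℝ)).indicator _ u) t]
    refine lintegral_congr_ae ?_
    filter_upwards [Measure.ae_ne volume (0 : ℝ)] with s hs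
    by_cases h1 : 0 < s
    · by_cases h2 : s < t <;> simp [Set.indicator, h1, h2, h1.le]
    · have h3 : ¬ (0 ≤ s) := fun h => h1 (lt_of_le_of_ne h (Ne.symm hs))
      simp [Set.indicator, h1, h3]

instance isFiniteMeasure_restrict_orthant (n : ℕ) (t : ℝ) :
    IsFiniteMeasure ((orthant n).restrict {w | ∑ i, w i ≤ t}) := by
  refine ⟨?_⟩
  rw [Measure.restrict_apply_univ]
  refine (measure_mono (t := {w : Fin n → ℝ | ∑ i, w i ≤ max t 0}) fun w hw => ?_).trans_lt ?_
  · exact (show ∑ i, w i ≤ t from hw).trans (le_max_left _ _)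
  · rw [orthant_sum_le (le_max_right _ _)]
    exact ENNReal.ofReal_lt_top

theorem isProbabilityMeasure_clockLaw (m : ℝ) {t : ℝ} (ht : 0 ≤ t) :
    IsProbabilityMeasure (clockLaw m t) := by
  refine ⟨?_⟩
  rw [← lintegral_one, lintegral_clockLaw m t measurable_const]
  simp only [lintegral_one, Measure.restrict_apply_univ, orthant_sum_le ht]
  rw [ENNReal.tsum_mul_left, ← ENNReal.ofReal_tsum_of_nonneg (fun n => by positivity)
      (Real.summable_pow_div_factorial _), ← ENNReal.ofReal_mul (Real.exp_pos _).le,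
      ← congrFun (NormedSpace.exp_eq_tsum_div (𝔸 := ℝ)) t, ← Real.exp_eq_exp_ℝ, ← Real.exp_add]
  simp

/-- Each stretch of the path is reset at most `n` times, so it contributes at least `m^n` times its
length. -/
theorem pow_mul_le_clock {m : ℝ} (hm0 : 0 < m) (hm1 : m < 1) {t : ℝ} {n : ℕ} {w : Fin n → ℝ}
    (hw : ∀ i, 0 < w i) (h : ∑ i, w i ≤ t) : m ^ n * t ≤ clock m t w := by
  have h1 : ∑ i : Fin n, (1 - m ^ ((i : ℕ) + 1)) * w i ≤ ∑ i : Fin n, (1 - m ^ n) * w i :=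
    Finset.sum_le_sum fun i _ => mul_le_mul_of_nonneg_right
      (sub_le_sub_left (pow_le_pow_of_le_one hm0.le hm1.le i.2) _) (hw i).le
  have h2 : m ^ n ≤ 1 := pow_le_one₀ hm0.le hm1.le
  rw [← Finset.mul_sum] at h1
  unfold clock
  nlinarith

/-- With `n` resets the variance parameter is at least `m^n t`, so `u^{-a}` grows at most
geometrically in `n`, while the simplex has volume `t^n / n!`. -/
theorem lintegral_clockLaw_rpow_lt_top {m : ℝ} (hm0 : 0 < m) (hm1 : m < 1) {t : ℝ} (ht : 0 < t)
    {a : ℝ} (ha : 0 ≤ a) : ∫⁻ u, ENNReal.ofReal (u ^ (-a)) ∂(clockLaw m t) < ∞ := by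
  rw [lintegral_clockLaw m t (by fun_prop)]
  have hbound : ∀ n : ℕ, ∫⁻ w in {w | ∑ i, w i ≤ t},
        ENNReal.ofReal (clock m t w ^ (-a)) ∂(orthant n)
      ≤ ENNReal.ofReal (t ^ (-a) * ((m ^ (-a) * t) ^ n / n.factorial)) := by
    intro n
    have h1 : ∀ᵐ w ∂((orthant n).restrict {w | ∑ i, w i ≤ t}),
        ENNReal.ofReal (clock m t w ^ (-a)) ≤ ENNReal.ofReal ((m ^ n * t) ^ (-a)) := by
      filter_upwards [ae_restrict_mem (measurableSet_sum_le n t),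
        ae_restrict_of_ae (ae_orthant_pos n)] with w h1 h2
      exact ENNReal.ofReal_le_ofReal (Real.rpow_le_rpow_of_nonpos (by positivity)
        (pow_mul_le_clock hm0 hm1 h2 h1) (by linarith))
    refine (lintegral_mono_ae h1).trans_eq ?_
    rw [lintegral_const, Measure.restrict_apply_univ, orthant_sum_le ht.le,
      ← ENNReal.ofReal_mul (by positivity)]
    congr 1
    rw [Real.mul_rpow (by positivity) ht.le, mul_pow, ← Real.rpow_natCast m n,
      ← Real.rpow_mul hm0.le, ← Real.rpow_natCast (m ^ (-a)) n, ← Real.rpow_mul hm0.le,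
      mul_comm (n : ℝ)]
    ring
  rw [ENNReal.tsum_mul_left]
  refine ENNReal.mul_lt_top ENNReal.ofReal_lt_top
    ((ENNReal.tsum_le_tsum hbound).trans_lt ?_)
  rw [← ENNReal.ofReal_tsum_of_nonneg (fun n => by positivity)
      ((Real.summable_pow_div_factorial _).mul_left _)]
  exact ENNReal.ofReal_lt_top

theorem ae_clockLaw_pos {m : ℝ} (hm0 : 0 < m) (hm1 : m < 1) {t : ℝ} (ht : 0 < t) :
    ∀ᵐ u ∂(clockLaw m t), 0 < u := by
  rw [clockLaw, Measure.ae_sum_iff]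
  intro n
  refine Measure.ae_smul_measure ?_ _
  rw [ae_map_iff (measurable_clock m t n).aemeasurable measurableSet_Ioi]
  filter_upwards [ae_restrict_mem (measurableSet_sum_le n t),
    ae_restrict_of_ae (ae_orthant_pos n)] with w h1 h2
  exact lt_of_lt_of_le (by positivity) (pow_mul_le_clock hm0 hm1 h2 h1)

/-! ### The density as a mixture of heat kernels -/

/-- The transition density `p(t; 0, y)` of Brownian motion with partial resetting, as a mixture of
heat kernels. -/
def resetDensity (d : ℕ) (m t : ℝ) (y : Space d) : ℝ :=
  ∫ u, heatKernel d u 0 y ∂(clockLaw m t)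

section ResetDensity

variable {d : ℕ} {m t : ℝ}

theorem heatKernel_le {u : ℝ} (hu : 0 < u) (y : Space d) :
    heatKernel d u 0 y ≤ (4 * Real.pi) ^ (-(d : ℝ) / 2) * u ^ (-((d : ℝ) / 2)) := by
  rw [heatKernel_eq hu]
  have : Real.exp (-‖y‖ ^ 2 / (4 * u)) ≤ 1 := by
    rw [Real.exp_le_one_iff, neg_div, neg_nonpos]; positivity
  have hpi := Real.pi_pos
  gcongr
  exact mul_le_of_le_one_right (by positivity) this

theorem integrable_clockLaw_rpow (hm0 : 0 < m) (hm1 : m < 1) (ht : 0 < t) :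
    Integrable (fun u : ℝ => (4 * Real.pi) ^ (-(d : ℝ) / 2) * u ^ (-((d : ℝ) / 2)))
      (clockLaw m t) := by
  refine Integrable.const_mul ⟨by fun_prop, ?_⟩ _
  rw [hasFiniteIntegral_iff_ofReal]
  · exact lintegral_clockLaw_rpow_lt_top hm0 hm1 ht (by positivity)
  · filter_upwards [ae_clockLaw_pos hm0 hm1 ht] with u hu
    show (0 : ℝ) ≤ _
    positivity

theorem ae_norm_heatKernel_le (hm0 : 0 < m) (hm1 : m < 1) (ht : 0 < t) (y : Space d) :
    ∀ᵐ u ∂(clockLaw m t), ‖heatKernel d u 0 y‖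
      ≤ (4 * Real.pi) ^ (-(d : ℝ) / 2) * u ^ (-((d : ℝ) / 2)) := by
  filter_upwards [ae_clockLaw_pos hm0 hm1 ht] with u hu
  rw [Real.norm_of_nonneg (heatKernel_nonneg hu.le _ _)]
  exact heatKernel_le hu y

/-- The heat kernels are dominated by a multiple of `u^{-d/2}`, uniformly in `y`, and this is
integrable against `clockLaw`. -/
theorem continuous_resetDensity (hm0 : 0 < m) (hm1 : m < 1) (ht : 0 < t) :
    Continuous (resetDensity d m t) := by
  refine continuous_of_dominated
    (fun y => (measurable_heatKernel_left 0 y).aestronglyMeasurable)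
    (ae_norm_heatKernel_le hm0 hm1 ht) (integrable_clockLaw_rpow hm0 hm1 ht)
    (ae_of_all _ fun u => ?_)
  unfold heatKernel
  fun_prop

theorem integrable_heatKernel_clockLaw (hm0 : 0 < m) (hm1 : m < 1) (ht : 0 < t) (y : Space d) :
    Integrable (fun u => heatKernel d u 0 y) (clockLaw m t) :=
  (integrable_clockLaw_rpow hm0 hm1 ht).mono' (measurable_heatKernel_left 0 y).aestronglyMeasurable
    (ae_norm_heatKernel_le hm0 hm1 ht y)

theorem ae_heatKernel_nonneg (hm0 : 0 < m) (hm1 : m < 1) (ht : 0 < t) (y : Space d) :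
    0 ≤ᵐ[clockLaw m t] fun u => heatKernel d u 0 y := by
  filter_upwards [ae_clockLaw_pos hm0 hm1 ht] with u hu using heatKernel_nonneg hu.le _ _

theorem resetDensity_nonneg (hm0 : 0 < m) (hm1 : m < 1) (ht : 0 < t) (y : Space d) :
    0 ≤ resetDensity d m t y :=
  integral_nonneg_of_ae (ae_heatKernel_nonneg hm0 hm1 ht y)

theorem ofReal_resetDensity (hm0 : 0 < m) (hm1 : m < 1) (ht : 0 < t) (y : Space d) :
    ENNReal.ofReal (resetDensity d m t y)
      = ∫⁻ u, ENNReal.ofReal (heatKernel d u 0 y) ∂(clockLaw m t) :=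
  ofReal_integral_eq_lintegral_ofReal (integrable_heatKernel_clockLaw hm0 hm1 ht y)
    (ae_heatKernel_nonneg hm0 hm1 ht y)

end ResetDensity

/-! ### Asymptotics of both densities -/

section Asymptotics

variable {d : ℕ} {m t : ℝ} {y : Space d}

theorem lintegral_exp_mul_heatKernel (hd : 1 ≤ d) {β : ℝ} (hβ : 0 < β) (hy : 1 ≤ ‖y‖) :
    ∫⁻ u in Set.Ioi 0, ENNReal.ofReal (Real.exp (-β * u)) * ENNReal.ofReal (heatKernel d u 0 y)
      = ENNReal.ofReal (potential d β y) := by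
  rw [potential, ofReal_integral_eq_lintegral_ofReal (integrableOn_potential hd hβ hy)]
  · simp only [ENNReal.ofReal_mul (Real.exp_pos _).le]
  · filter_upwards [ae_restrict_mem measurableSet_Ioi] with u hu
    exact mul_nonneg (Real.exp_pos _).le (heatKernel_nonneg (le_of_lt hu) _ _)

theorem lintegral_exp_mul_inv_mul_heatKernel (hy : 1 ≤ ‖y‖) :
    ∫⁻ u in Set.Ioi 0, ENNReal.ofReal (Real.exp (-u)) *
        (ENNReal.ofReal u⁻¹ * ENNReal.ofReal (heatKernel d u 0 y))
      = ENNReal.ofReal ((4 * Real.pi) ^ (-(d : ℝ) / 2) * besselIntegral (d / 2 + 1) ‖y‖) := by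
  have hpi := Real.pi_pos
  have hfun : ∀ u ∈ Set.Ioi (0 : ℝ), (4 * Real.pi) ^ (-(d : ℝ) / 2) *
      (u ^ (-((d : ℝ) / 2 + 1)) * Real.exp (-u - ‖y‖ ^ 2 / (4 * u)))
      = Real.exp (-u) * (u⁻¹ * heatKernel d u 0 y) := by
    intro u hu
    have hu : 0 < u := hu
    rw [heatKernel_eq hu, neg_add, Real.rpow_add hu, Real.rpow_neg_one, sub_eq_add_neg,
      Real.exp_add, neg_div]
    ring_nf
  have hint : IntegrableOn (fun u => u ^ (-((d : ℝ) / 2 + 1)) *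
      Real.exp (-u - ‖y‖ ^ 2 / (4 * u))) (Set.Ioi 0) := by
    refine (integrableOn_exp_rpow_exp (a := (d : ℝ) / 2 + 1) (β := 1) (by positivity) one_pos
      hy).congr_fun (fun u _ => ?_) measurableSet_Ioi
    simp only [sub_eq_add_neg, Real.exp_add, neg_div, neg_one_mul]
    ring
  rw [besselIntegral, ← integral_const_mul, ofReal_integral_eq_lintegral_ofReal (hint.const_mul _)]
  · refine setLIntegral_congr_fun measurableSet_Ioi fun u hu => ?_
    have hu' : 0 < u := hu
    simp only [hfun u hu]
    rw [ENNReal.ofReal_mul (Real.exp_pos _).le, ENNReal.ofReal_mul (by positivity)]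
  · filter_upwards [ae_restrict_mem measurableSet_Ioi] with u hu
    have hu : 0 < u := hu
    show (0 : ℝ) ≤ _
    positivity

theorem resetDensity_le (hd : 1 ≤ d) (hm0 : 0 < m) (hm1 : m < 1) (ht : 0 < t) (hy : 1 ≤ ‖y‖) :
    resetDensity d m t y ≤ Real.exp (-t) * heatKernel d t 0 y +
      1 / qPochhammerInf m m * potential d 1 y := by
  have hZ := qPochhammerInf_pos hm0 hm1
  have hk := heatKernel_nonneg ht.le 0 y
  have hp := potential_nonneg d 1 y
  rw [← ENNReal.ofReal_le_ofReal_iff (by positivity), ENNReal.ofReal_add (by positivity)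
    (by positivity), ENNReal.ofReal_mul (Real.exp_pos _).le, ENNReal.ofReal_mul (by positivity),
    ofReal_resetDensity hm0 hm1 ht, ← lintegral_exp_mul_heatKernel hd one_pos hy]
  refine (lintegral_clockLaw_le hm0 hm1 ht.le (measurable_heatKernel_left 0 y).ennreal_ofReal).trans ?_
  simp only [neg_one_mul]
  gcongr
  exact Set.Ioo_subset_Ioi_self

/-- The first error carries the weight `1/u`. The other two, the tail `u ≥ t` and the term
`e^{-t+m(t-u)}` on `u < t`, are both bounded through `e^{-θt} e^{-(1-θ)u}`: the tail since `θ(u - t)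
≥ 0`, the other since `(1 - m - θ)(t - u) ≥ 0`. -/
theorem le_resetDensity_add (hd : 1 ≤ d) (hm0 : 0 < m) (hm1 : m < 1) (ht : 0 < t) (hy : 1 ≤ ‖y‖)
    {θ : ℝ} (hθ0 : 0 ≤ θ) (hθ1 : θ ≤ 1 - m) :
    1 / qPochhammerInf m m * potential d 1 y ≤ resetDensity d m t y +
      1 / qPochhammerInf m m * (m / (1 - m) ^ 2) *
        ((4 * Real.pi) ^ (-(d : ℝ) / 2) * besselIntegral (d / 2 + 1) ‖y‖) +
      (1 / qPochhammerInf m m / (1 - m) + 1 / qPochhammerInf m m) *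
        (Real.exp (-θ * t) * potential d (1 - θ) y) := by
  have hZ := qPochhammerInf_pos hm0 hm1
  have h1m : 0 < 1 - m := sub_pos.2 hm1
  have hpi := Real.pi_pos
  have hr := resetDensity_nonneg hm0 hm1 ht y
  have hp := potential_nonneg d 1 y
  have hpθ := potential_nonneg d (1 - θ) y
  have hb : 0 ≤ besselIntegral (d / 2 + 1) ‖y‖ :=
    setIntegral_nonneg measurableSet_Ioi fun u hu => by have : 0 < u := hu; positivity
  set Z := 1 / qPochhammerInf m m with hZdef
  have hZ0 : 0 < Z := by positivity
  set g : ℝ → ℝ≥0∞ := fun u => ENNReal.ofReal (heatKernel d u 0 y) with hg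
  have hgm : Measurable g := (measurable_heatKernel_left 0 y).ennreal_ofReal
  set E := ENNReal.ofReal (Real.exp (-θ * t) * potential d (1 - θ) y) with hE
  have hE' : E = ∫⁻ u in Set.Ioi 0, ENNReal.ofReal (Real.exp (-θ * t + -(1 - θ) * u)) * g u := by
    rw [hE, ENNReal.ofReal_mul (Real.exp_pos _).le, ← lintegral_exp_mul_heatKernel hd
      (by linarith) hy, ← lintegral_const_mul' _ _ ENNReal.ofReal_ne_top]
    congr 1 with u
    rw [Real.exp_add, ENNReal.ofReal_mul (Real.exp_pos _).le, mul_assoc]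
  have htail : ∫⁻ u in Set.Ici t, ENNReal.ofReal (Real.exp (-u)) * g u ≤ E := by
    rw [hE']
    refine (setLIntegral_mono' measurableSet_Ici fun u hu => ?_).trans
      (lintegral_mono_set fun u hu => ht.trans_le hu)
    have : t ≤ u := hu
    gcongr
    nlinarith
  have hsmall : ∫⁻ u in Set.Ioo 0 t, ENNReal.ofReal (Real.exp (-t + m * (t - u))) * g u ≤ E := by
    rw [hE']
    refine (setLIntegral_mono' measurableSet_Ioo fun u hu => ?_).trans
      (lintegral_mono_set Set.Ioo_subset_Ioi_self)
    have : u < t := hu.2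
    refine mul_le_mul_left (ENNReal.ofReal_le_ofReal (Real.exp_le_exp.2 ?_)) _
    nlinarith
  rw [← ENNReal.ofReal_le_ofReal_iff (by positivity), ENNReal.ofReal_add (by positivity)
    (by positivity), ENNReal.ofReal_add (by positivity) (by positivity),
    ENNReal.ofReal_mul (p := Z / (1 - m) + Z) (by positivity),
    ENNReal.ofReal_add (p := Z / (1 - m)) (by positivity) (by positivity), ← hE,
    ENNReal.ofReal_mul (p := Z) (by positivity),
    ENNReal.ofReal_mul (p := Z * (m / (1 - m) ^ 2)) (by positivity),
    ofReal_resetDensity hm0 hm1 ht, ← lintegral_exp_mul_heatKernel hd one_pos hy,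
    ← lintegral_exp_mul_inv_mul_heatKernel hy]
  have hsplit : ∫⁻ u in Set.Ioi 0, ENNReal.ofReal (Real.exp (-1 * u)) * g u
      ≤ (∫⁻ u in Set.Ioo 0 t, ENNReal.ofReal (Real.exp (-u)) * g u) + E := by
    rw [← Set.Ioo_union_Ici_eq_Ioi ht]
    simp only [neg_one_mul]
    exact (lintegral_union_le _ _ _).trans (add_le_add le_rfl htail)
  have hmain := le_lintegral_clockLaw_add hm0 hm1 ht.le hgm
  rw [← hZdef] at hmain
  calc ENNReal.ofReal Z * ∫⁻ u in Set.Ioi 0, ENNReal.ofReal (Real.exp (-1 * u)) * g u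
      ≤ ENNReal.ofReal Z * ((∫⁻ u in Set.Ioo 0 t, ENNReal.ofReal (Real.exp (-u)) * g u) + E) := by
        gcongr
    _ = ENNReal.ofReal Z * (∫⁻ u in Set.Ioo 0 t, ENNReal.ofReal (Real.exp (-u)) * g u) +
        ENNReal.ofReal Z * E := mul_add _ _ _
    _ ≤ (∫⁻ u, g u ∂(clockLaw m t) + ENNReal.ofReal (Z * (m / (1 - m) ^ 2)) *
          (∫⁻ u in Set.Ioi 0, ENNReal.ofReal (Real.exp (-u)) * (ENNReal.ofReal u⁻¹ * g u)) +
        ENNReal.ofReal (Z / (1 - m)) * E) + ENNReal.ofReal Z * E := by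
        refine add_le_add (hmain.trans (add_le_add (add_le_add le_rfl ?_) ?_)) le_rfl
        · exact mul_le_mul_right (lintegral_mono_set Set.Ioo_subset_Ioi_self) _
        · exact mul_le_mul_right hsmall _
    _ = _ := by rw [add_mul, add_assoc]

theorem leadingTerm_pos (hm0 : 0 < m) (hm1 : m < 1) (hy : 0 < ‖y‖) : 0 < leadingTerm d m y := by
  have hZ := qPochhammerInf_pos hm0 hm1
  have hpi := Real.pi_pos
  unfold leadingTerm
  positivity

/-- For `|y| ≤ 2t` the leading term is at least a multiple of `t^{-(d-1)/2} e^{-|y|}`, and `e^{-ηt}`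
is smaller than a multiple of `t^{-(d+1)/2}`. Every exponentially small error is absorbed this way.
-/
theorem exists_exp_le_leadingTerm (hd : 1 ≤ d) (hm0 : 0 < m) (hm1 : m < 1) {η : ℝ} (hη : 0 < η) :
    ∃ C : ℝ, 0 < C ∧ ∀ (t : ℝ) (y : Space d), 0 < t → 0 < ‖y‖ → ‖y‖ ≤ 2 * t →
      Real.exp (-η * t - ‖y‖) ≤ C / t * leadingTerm d m y := by
  have hZ := qPochhammerInf_pos hm0 hm1
  have hpi := Real.pi_pos
  have hd' : (1 : ℝ) ≤ d := by exact_mod_cast hd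
  set c₀ := 1 / 2 * (1 / qPochhammerInf m m) * (2 * Real.pi) ^ (-((d : ℝ) - 1) / 2) with hc₀
  have hc₀pos : 0 < c₀ := by positivity
  set a : ℝ := ((d : ℝ) + 1) / 2 with ha
  have ha0 : 0 < a := by positivity
  refine ⟨(a / η) ^ a * 2 ^ (((d : ℝ) - 1) / 2) / c₀, by positivity, fun t y ht hy hyt => ?_⟩
  have h1 : t ^ a * Real.exp (-η * t) ≤ (a / η) ^ a := by
    have := rpow_neg_mul_exp_le ha0 hη (inv_pos.2 ht)
    rwa [Real.rpow_neg (inv_pos.2 ht).le, Real.inv_rpow ht.le, inv_inv, div_inv_eq_mul] at this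
  have h2 : (2 * t) ^ (-((d : ℝ) - 1) / 2) ≤ ‖y‖ ^ (-((d : ℝ) - 1) / 2) :=
    Real.rpow_le_rpow_of_nonpos hy hyt (by linarith)
  have h3 : (2 * t) ^ (-((d : ℝ) - 1) / 2) = (2 ^ (((d : ℝ) - 1) / 2))⁻¹ * (t * (t ^ a)⁻¹) := by
    rw [Real.mul_rpow (by norm_num) ht.le, neg_div, Real.rpow_neg (by norm_num)]
    congr 1
    rw [← Real.rpow_neg ht.le]
    nth_rw 2 [← Real.rpow_one t]
    rw [← Real.rpow_add ht, ha]
    ring_nf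
  have hlead : leadingTerm d m y = c₀ * ‖y‖ ^ (-((d : ℝ) - 1) / 2) * Real.exp (-‖y‖) := by
    rw [leadingTerm, hc₀]
  have hta : 0 < t ^ a := by positivity
  rw [hlead, sub_eq_add_neg, Real.exp_add, ← mul_assoc]
  refine mul_le_mul_of_nonneg_right ?_ (Real.exp_pos _).le
  calc Real.exp (-η * t) ≤ (a / η) ^ a * (t ^ a)⁻¹ := by
        rw [← div_eq_mul_inv, le_div_iff₀ hta, mul_comm]; exact h1
    _ = (a / η) ^ a * 2 ^ (((d : ℝ) - 1) / 2) / c₀ / t * (c₀ * (2 * t) ^ (-((d : ℝ) - 1) / 2)) := by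
        rw [h3]; field_simp
    _ ≤ _ := by gcongr

theorem abs_potential_sub_leadingTerm_le (hm0 : 0 < m) (hm1 : m < 1)
    (hy : 0 < ‖y‖) (hyd : (2 - 2 * ((d : ℝ) / 2)) ^ 2 ≤ ‖y‖) :
    |1 / qPochhammerInf m m * potential d 1 y - leadingTerm d m y|
      ≤ 2 * ((2 - 2 * ((d : ℝ) / 2)) ^ 2 + 1) / ‖y‖ * leadingTerm d m y := by
  have hZ := qPochhammerInf_pos hm0 hm1
  have hpi := Real.pi_pos
  set P := (4 * Real.pi) ^ (-(d : ℝ) / 2) with hP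
  have hP0 : 0 < P := by positivity
  rw [leadingTerm_eq_besselLeading (norm_pos_iff.1 hy), potential_one_eq, ← hP]
  calc |1 / qPochhammerInf m m * (P * besselIntegral (d / 2) ‖y‖) -
        1 / qPochhammerInf m m * (P * besselLeading (d / 2) ‖y‖)|
      = 1 / qPochhammerInf m m * (P *
          |besselIntegral (d / 2) ‖y‖ - besselLeading (d / 2) ‖y‖|) := by
        rw [← mul_sub, ← mul_sub, abs_mul, abs_mul, abs_of_pos hP0, abs_of_pos (by positivity)]
    _ ≤ 1 / qPochhammerInf m m * (P * (2 * ((2 - 2 * ((d : ℝ) / 2)) ^ 2 + 1) / ‖y‖ *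
          besselLeading (d / 2) ‖y‖)) := by
        gcongr
        exact abs_besselIntegral_sub_le hyd hy
    _ = _ := by ring

theorem besselIntegral_add_one_le (hm0 : 0 < m) (hm1 : m < 1) (hy : 1 ≤ ‖y‖)
    (hyd : (2 - 2 * ((d : ℝ) / 2 + 1)) ^ 2 ≤ ‖y‖) :
    1 / qPochhammerInf m m * ((4 * Real.pi) ^ (-(d : ℝ) / 2) * besselIntegral (d / 2 + 1) ‖y‖)
      ≤ (1 + 2 * ((2 - 2 * ((d : ℝ) / 2 + 1)) ^ 2 + 1)) * 2 / ‖y‖ * leadingTerm d m y := by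
  have hZ := qPochhammerInf_pos hm0 hm1
  have hpi := Real.pi_pos
  have hy0 : 0 < ‖y‖ := one_pos.trans_le hy
  set K : ℝ := 2 * ((2 - 2 * ((d : ℝ) / 2 + 1)) ^ 2 + 1) with hK
  have hK0 : 0 ≤ K := by positivity
  have hB := besselLeading_pos (a := (d : ℝ) / 2 + 1) hy0
  have h := (abs_le.1 (abs_besselIntegral_sub_le hyd hy0)).2
  have h1 : K / ‖y‖ * besselLeading (d / 2 + 1) ‖y‖ ≤ K * besselLeading (d / 2 + 1) ‖y‖ := by
    gcongr
    exact div_le_self hK0 hy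
  have h2 : besselIntegral (d / 2 + 1) ‖y‖ ≤ (1 + K) * (2 / ‖y‖ * besselLeading (d / 2) ‖y‖) := by
    rw [← besselLeading_add_one hy0]
    linarith
  rw [leadingTerm_eq_besselLeading (norm_pos_iff.1 hy0)]
  calc _ ≤ 1 / qPochhammerInf m m * ((4 * Real.pi) ^ (-(d : ℝ) / 2) *
        ((1 + K) * (2 / ‖y‖ * besselLeading (d / 2) ‖y‖))) := by gcongr
    _ = _ := by ring

/-- Completing the square: `t + |y|²/(4t) = |y| + (2t - |y|)²/(4t)`, and the square is bounded away
from zero relative to `t²` because `|y| ≤ 2qt` with `q < 1`. -/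
theorem exp_mul_heatKernel_le {q : ℝ} (hq : q < 1) (ht : 1 ≤ t) (hyq : ‖y‖ ≤ 2 * q * t) :
    Real.exp (-t) * heatKernel d t 0 y ≤ Real.exp (-(1 - q) ^ 2 * t - ‖y‖) := by
  have ht0 : 0 < t := one_pos.trans_le ht
  have hk : heatKernel d t 0 y ≤ Real.exp (-‖y‖ ^ 2 / (4 * t)) := by
    rw [heatKernel, sub_zero]
    refine mul_le_of_le_one_left (Real.exp_pos _).le ?_
    refine Real.rpow_le_one_of_one_le_of_nonpos ?_ (by rw [neg_div, neg_nonpos]; positivity)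
    nlinarith [Real.pi_gt_three]
  refine (mul_le_mul_of_nonneg_left hk (Real.exp_pos _).le).trans ?_
  rw [← Real.exp_add, Real.exp_le_exp, neg_div]
  have h1 : t + ‖y‖ ^ 2 / (4 * t) - ‖y‖ = (2 * t - ‖y‖) ^ 2 / (4 * t) := by
    field_simp; ring
  have h2 : (1 - q) ^ 2 * t ≤ (2 * t - ‖y‖) ^ 2 / (4 * t) := by
    rw [le_div_iff₀ (by positivity)]
    have h3 : 2 * (1 - q) * t ≤ 2 * t - ‖y‖ := by linarith
    have h4 : 0 ≤ 2 * (1 - q) * t := by have := sub_pos.2 hq; positivity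
    nlinarith
  linarith

theorem norm_mem_of_region {δ : ℝ} (hδ : 0 < δ) (ht : 0 < t)
    (h1 : m ^ 2 + δ ≤ ‖y‖ ^ 2 / (4 * t ^ 2)) (h2 : ‖y‖ ^ 2 / (4 * t ^ 2) ≤ 1 - δ) :
    2 * √δ * t ≤ ‖y‖ ∧ ‖y‖ ≤ 2 * √(1 - δ) * t := by
  rw [le_div_iff₀ (by positivity)] at h1
  have h1δ : 0 ≤ 1 - δ := le_trans (by positivity) h2
  rw [div_le_iff₀ (by positivity)] at h2
  constructor
  · refine (abs_le_of_sq_le_sq' ?_ (norm_nonneg y)).2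
    rw [mul_pow, mul_pow, Real.sq_sqrt hδ.le]
    nlinarith [mul_nonneg (sq_nonneg m) (sq_nonneg t)]
  · refine (abs_le_of_sq_le_sq' ?_ (by positivity)).2
    rw [mul_pow, mul_pow, Real.sq_sqrt h1δ]
    linarith

/-- Both densities are compared with the potential kernel at `β = 1`. Each error is a constant times
`L/t`, either because it carries a factor `1/|y|` or because it is exponentially smaller than
`e^{-|y|}`. -/
theorem exists_asymptotics (hd : 1 ≤ d) (hm0 : 0 < m) (hm1 : m < 1) {δ : ℝ} (hδ : 0 < δ) :
    ∃ C t₀ : ℝ, 0 < C ∧ 1 ≤ t₀ ∧ ∀ (t : ℝ) (y : Space d), t₀ ≤ t →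
      m ^ 2 + δ ≤ ‖y‖ ^ 2 / (4 * t ^ 2) → ‖y‖ ^ 2 / (4 * t ^ 2) ≤ 1 - δ → 0 < ‖y‖ ∧
      |rho d m y - leadingTerm d m y| ≤ C / t * leadingTerm d m y ∧
      |resetDensity d m t y - leadingTerm d m y| ≤ C / t * leadingTerm d m y := by
  have hZ := qPochhammerInf_pos hm0 hm1
  have h1m : 0 < 1 - m := sub_pos.2 hm1
  set Z := 1 / qPochhammerInf m m with hZdef
  have hZ0 : 0 < Z := by positivity
  have hs : 0 < √δ := Real.sqrt_pos.2 hδ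
  set q := √(1 - δ) with hq
  have hq0 : 0 ≤ q := Real.sqrt_nonneg _
  have hq1 : q < 1 := by rw [hq, Real.sqrt_lt' one_pos]; linarith
  -- the parameters of the exponential tilting
  set ε := min (1 - q) ((1 - m) / 2) with hε
  have hε0 : 0 < ε := lt_min (sub_pos.2 hq1) (by positivity)
  have hεq : ε ≤ 1 - q := min_le_left _ _
  have hεm : ε ≤ (1 - m) / 2 := min_le_right _ _
  -- The tilt must satisfy `2qε < θ < 2ε - ε²`. The right inequality gives `(1 - ε)² < 1 - θ`, hence
  -- decay `e^{-(1-ε)|y|}` of the tilted potential kernel. The left one makes `θt - ε|y|` at least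
  -- `ε(1-q)t/2` when `|y| ≤ 2qt`. Also `θ ≤ 2ε ≤ 1 - m`.
  set θ := ε * (1 + 3 * q) / 2 with hθ
  have hθ0 : 0 ≤ θ := by positivity
  have hθm : θ ≤ 1 - m := by nlinarith
  have hγ : (1 - ε) ^ 2 < 1 - θ := by nlinarith
  obtain ⟨Kθ, hKθ, hpotθ⟩ := exists_potential_le hd hγ
  obtain ⟨C₁, hC₁, hE₁⟩ := exists_exp_le_leadingTerm hd hm0 hm1
    (show 0 < (1 - q) ^ 2 from pow_pos (sub_pos.2 hq1) 2)
  obtain ⟨C₂, hC₂, hE₂⟩ := exists_exp_le_leadingTerm hd hm0 hm1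
    (show 0 < ε * (1 - q) / 2 by have := sub_pos.2 hq1; positivity)
  have hminv : 1 < m⁻¹ := (one_lt_inv₀ hm0).2 hm1
  -- A decay rate strictly between `1` and `m^{-1/2}`; the surplus `(γ - 1)|y| ≥ (γ - 1) 2√δ t`
  -- makes the terms `k ≥ 1` of `rho` negligible.
  set γ := √((1 + m⁻¹) / 2) with hγdef
  have hγ1 : 1 < γ := by rw [hγdef, Real.lt_sqrt one_pos.le]; linarith
  have hγ2 : γ ^ 2 < m⁻¹ := by rw [hγdef, Real.sq_sqrt (by positivity)]; linarith
  obtain ⟨K₃, hK₃, hpot₃⟩ := exists_potential_le hd hγ2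
  obtain ⟨C₃, hC₃, hE₃⟩ := exists_exp_le_leadingTerm hd hm0 hm1
    (show 0 < (γ - 1) * (2 * √δ) by have := sub_pos.2 hγ1; positivity)
  set K₁ : ℝ := 2 * ((2 - 2 * ((d : ℝ) / 2)) ^ 2 + 1) with hK₁
  set K₂ : ℝ := (1 + 2 * ((2 - 2 * ((d : ℝ) / 2 + 1)) ^ 2 + 1)) * 2 with hK₂
  have hK₁0 : 0 < K₁ := by positivity
  have hK₂0 : 0 < K₂ := by positivity
  -- Once `|y| ≥ R`, one has `|y| ≥ 1` and both Laplace estimates apply, with indices `d/2` and `d/2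
  -- + 1`.
  set R : ℝ := 1 + (2 - 2 * ((d : ℝ) / 2)) ^ 2 + (2 - 2 * ((d : ℝ) / 2 + 1)) ^ 2 with hR
  set A₁ := K₁ / (2 * √δ) with hA₁
  set A₂ := m / (1 - m) ^ 2 * (K₂ / (2 * √δ)) with hA₂
  set A₃ := (Z / (1 - m) + Z) * (Kθ * C₂) with hA₃
  set A₄ := Z * (Z / (1 - m) * (K₃ * C₃)) with hA₄
  have hA₁0 : 0 < A₁ := by positivity
  have hA₂0 : 0 < A₂ := by positivity
  have hA₃0 : 0 < A₃ := by positivity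
  have hA₄0 : 0 < A₄ := by positivity
  refine ⟨A₁ + A₂ + A₃ + A₄ + C₁, max 1 (R / (2 * √δ)), by positivity, le_max_left _ _,
    fun t y ht hreg₁ hreg₂ => ?_⟩
  have ht1 : 1 ≤ t := (le_max_left _ _).trans ht
  have ht0 : 0 < t := one_pos.trans_le ht1
  obtain ⟨hylow, hyup⟩ := norm_mem_of_region hδ ht0 hreg₁ hreg₂
  rw [← hq] at hyup
  have hyR : R ≤ ‖y‖ := by
    have := (le_max_right _ _).trans ht
    rw [div_le_iff₀ (by positivity)] at this
    linarith
  have hsq₁ := sq_nonneg (2 - 2 * ((d : ℝ) / 2))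
  have hsq₂ := sq_nonneg (2 - 2 * ((d : ℝ) / 2 + 1))
  have hy1 : 1 ≤ ‖y‖ := by linarith only [hyR, hR, hsq₁, hsq₂]
  have hyd₁ : (2 - 2 * ((d : ℝ) / 2)) ^ 2 ≤ ‖y‖ := by linarith only [hyR, hR, hsq₁, hsq₂]
  have hyd₂ : (2 - 2 * ((d : ℝ) / 2 + 1)) ^ 2 ≤ ‖y‖ := by linarith only [hyR, hR, hsq₁, hsq₂]
  have hy0 : 0 < ‖y‖ := one_pos.trans_le hy1
  have hy2t : ‖y‖ ≤ 2 * t := by nlinarith only [hyup, hq1, ht0]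
  have hL := leadingTerm_pos hm0 hm1 hy0
  set L := leadingTerm d m y with hLdef
  set ω := L / t with hω
  have hω0 : 0 < ω := by positivity
  have hdiv : ∀ K : ℝ, 0 ≤ K → K / ‖y‖ * L ≤ K / (2 * √δ) * ω := by
    intro K hK
    calc K / ‖y‖ * L ≤ K / (2 * √δ * t) * L := by gcongr
      _ = _ := by rw [hω]; field_simp
  have hmul : ∀ K : ℝ, K / t * L = K * ω := fun K => by rw [hω]; ring
  have hpot := (abs_potential_sub_leadingTerm_le hm0 hm1 hy0 hyd₁).trans (hdiv K₁ hK₁0.le)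
  rw [← hLdef, ← hZdef, ← hA₁] at hpot
  have hbes := (besselIntegral_add_one_le hm0 hm1 hy1 hyd₂).trans (hdiv K₂ hK₂0.le)
  rw [← hZdef] at hbes
  have h₁ := (exp_mul_heatKernel_le hq1 ht1 hyup).trans (hE₁ t y ht0 hy0 hy2t)
  have h₂ : Real.exp (-θ * t) * potential d (1 - θ) y ≤ Kθ * (C₂ * ω) := by
    rw [← hmul]
    refine le_trans ?_ (mul_le_mul_of_nonneg_left (hE₂ t y ht0 hy0 hy2t) hKθ.le)
    refine (mul_le_mul_of_nonneg_left (hpotθ y hy1) (Real.exp_pos _).le).trans ?_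
    rw [mul_left_comm, ← Real.exp_add]
    gcongr
    rw [hθ]
    nlinarith only [mul_le_mul_of_nonneg_left hyup hε0.le]
  have h₃ : potential d m⁻¹ y ≤ K₃ * (C₃ * ω) := by
    rw [← hmul]
    refine le_trans (hpot₃ y hy1) (le_trans ?_
      (mul_le_mul_of_nonneg_left (hE₃ t y ht0 hy0 hy2t) hK₃.le))
    gcongr
    nlinarith only [mul_le_mul_of_nonneg_left hylow (sub_pos.2 hγ1).le]
  rw [hmul] at h₁
  rw [hmul]
  refine ⟨hy0, ?_, ?_⟩
  · have hrho := abs_rho_sub_le hd hm0 hm1 hy1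
    rw [← hZdef] at hrho
    have : Z * (Z / (1 - m) * potential d m⁻¹ y) ≤ A₄ * ω := by
      calc _ ≤ Z * (Z / (1 - m) * (K₃ * (C₃ * ω))) := by gcongr
        _ = _ := by rw [hA₄]; ring
    have htri := abs_sub_le (rho d m y) (Z * potential d 1 y) L
    linarith only [hrho, this, htri, hpot, mul_pos hA₂0 hω0, mul_pos hA₃0 hω0, mul_pos hC₁ hω0]
  · have hup := resetDensity_le hd hm0 hm1 ht0 hy1
    have hlow := le_resetDensity_add hd hm0 hm1 ht0 hy1 hθ0 hθm
    rw [← hZdef] at hup hlow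
    have e₂ : Z * (m / (1 - m) ^ 2) * ((4 * Real.pi) ^ (-(d : ℝ) / 2) *
        besselIntegral (d / 2 + 1) ‖y‖) ≤ A₂ * ω := by
      calc _ = m / (1 - m) ^ 2 * (Z * ((4 * Real.pi) ^ (-(d : ℝ) / 2) *
            besselIntegral (d / 2 + 1) ‖y‖)) := by ring
        _ ≤ m / (1 - m) ^ 2 * (K₂ / (2 * √δ) * ω) := by gcongr
        _ = _ := by rw [hA₂]; ring
    have e₃ : (Z / (1 - m) + Z) * (Real.exp (-θ * t) * potential d (1 - θ) y) ≤ A₃ * ω := by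
      calc _ ≤ (Z / (1 - m) + Z) * (Kθ * (C₂ * ω)) := by gcongr
        _ = _ := by rw [hA₃]; ring
    obtain ⟨hp₁, hp₂⟩ := abs_le.1 hpot
    have p1 := mul_pos hA₁0 hω0
    have p2 := mul_pos hA₂0 hω0
    have p3 := mul_pos hA₃0 hω0
    have p4 := mul_pos hA₄0 hω0
    have p5 := mul_pos hC₁ hω0
    rw [abs_le]
    constructor <;> linarith only [hup, hlow, e₂, e₃, hp₁, hp₂, h₁, p1, p2, p3, p4, p5]

end Asymptotics

/-! ### Waiting times of the Poisson process -/

section Poisson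

theorem lintegral_expMeasure_one {f : ℝ → ℝ≥0∞} (hf : Measurable f) :
    ∫⁻ x, f x ∂(expMeasure 1) = ∫⁻ x in Set.Ioi 0, ENNReal.ofReal (Real.exp (-x)) * f x := by
  have hm : Measurable (exponentialPDF 1) := (measurable_exponentialPDFReal 1).ennreal_ofReal
  have h : expMeasure 1 = volume.withDensity (exponentialPDF 1) := rfl
  rw [h, lintegral_withDensity_eq_lintegral_mul _ hm hf, ← lintegral_indicator measurableSet_Ioi]
  refine lintegral_congr_ae ?_
  filter_upwards [Measure.ae_ne volume (0 : ℝ)] with x hx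
  rcases lt_or_gt_of_ne hx with h | h
  · simp [exponentialPDF_of_neg h, not_lt.2 h.le]
  · simp [exponentialPDF_of_nonneg h.le, h]

instance isProbabilityMeasure_expMeasure_one : IsProbabilityMeasure (expMeasure 1) :=
  isProbabilityMeasure_expMeasure one_pos

theorem expMeasure_one_Ioi {s : ℝ} (hs : 0 ≤ s) :
    expMeasure 1 (Set.Ioi s) = ENNReal.ofReal (Real.exp (-s)) := by
  rw [← lintegral_indicator_one measurableSet_Ioi,
    lintegral_expMeasure_one (measurable_one.indicator measurableSet_Ioi),
    ← lintegral_indicator measurableSet_Ioi, ← integral_exp_neg_Ioi,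
    ofReal_integral_eq_lintegral_ofReal (integrableOn_exp_neg_Ioi s)
      (ae_of_all _ fun x => (Real.exp_pos _).le), ← lintegral_indicator measurableSet_Ioi]
  congr 1 with x
  by_cases h1 : s < x
  · simp [Set.indicator, h1, hs.trans_lt h1]
  · simp [Set.indicator, h1]

theorem lintegral_pi_expMeasure (n : ℕ) {F : (Fin n → ℝ) → ℝ≥0∞} (hF : Measurable F) :
    ∫⁻ w, F w ∂(Measure.pi fun _ => expMeasure 1)
      = ∫⁻ w, ENNReal.ofReal (Real.exp (-∑ i, w i)) * F w ∂(orthant n) := by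
  induction n with
  | zero =>
    rw [lintegral_orthant_zero _ (by fun_prop), Measure.pi_of_empty, lintegral_dirac' _ hF]
    simp only [Finset.univ_eq_empty, Finset.sum_empty, neg_zero, Real.exp_zero, ENNReal.ofReal_one,
      one_mul]
    congr 1
    exact Subsingleton.elim _ _
  | succ n ih =>
    have hmeas : Measurable fun p : ℝ × (Fin n → ℝ) =>
        F (Fin.insertNth (α := fun _ => ℝ) 0 p.1 p.2) :=
      hF.comp (MeasurableEquiv.piFinSuccAbove (fun _ => ℝ) 0).symm.measurable
    rw [lintegral_pi_insertNth _ 0 hF, lintegral_orthant_succ 0 (by fun_prop),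
      lintegral_expMeasure_one hmeas.lintegral_prod_right']
    congr 1 with x
    rw [ih (F := fun v => F (Fin.insertNth 0 x v)) (hmeas.comp measurable_prodMk_left),
      ← lintegral_const_mul' _ _ ENNReal.ofReal_ne_top]
    congr 1 with v
    rw [sum_insertNth, neg_add, Real.exp_add, ENNReal.ofReal_mul (Real.exp_pos _).le, mul_assoc]

/-- The waiting times between the first `n` arrivals `τ 1, …, τ n`, listed backwards. -/
def backwardWaiting (τ : ℕ → ℝ≥0) (n : ℕ) (i : Fin n) : ℝ :=
  (τ (n - (i + 1) + 1) : ℝ) - τ (n - (i + 1))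

theorem sum_backwardWaiting (τ : ℕ → ℝ≥0) (n : ℕ) :
    ∑ i, backwardWaiting τ n i = (τ n : ℝ) - τ 0 := by
  have h1 := Fin.sum_univ_eq_sum_range
    (fun i => (τ (n - (i + 1) + 1) : ℝ) - τ (n - (i + 1))) n
  have h2 := Finset.sum_range_reflect (fun k => (τ (k + 1) : ℝ) - τ k) n
  rw [Finset.sum_range_sub (fun k => (τ k : ℝ))] at h2
  refine h1.trans (Eq.trans (Finset.sum_congr rfl fun i _ => ?_) h2)
  rw [Nat.sub_sub, Nat.add_comm i 1]

variable {Ω : Type*} [MeasurableSpace Ω] {P : Measure Ω} [IsProbabilityMeasure P]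
  {T : ℕ → Ω → ℝ≥0}

theorem IsPoissonArrivals.map_waiting (hT : IsPoissonArrivals T P) {n : ℕ} {g : Fin n → ℕ}
    (hg : Function.Injective g) :
    P.map (fun ω i => (T (g i + 1) ω : ℝ) - T (g i) ω) = Measure.pi fun _ => expMeasure 1 := by
  have h := hT.indep_waiting.precomp hg
  rw [iIndepFun_iff_map_fun_eq_pi_map fun i => (hT.law_waiting (g i)).aemeasurable] at h
  refine h.trans ?_
  congr 1 with i
  rw [(hT.law_waiting (g i)).map_eq]

/-- Given `n` arrivals before time `t`, the waiting times are uniformly distributed. -/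
theorem IsPoissonArrivals.setLIntegral_eq (hT : IsPoissonArrivals T P) (t : ℝ) (n : ℕ)
    {ψ : (Fin n → ℝ) → ℝ≥0∞} (hψ : Measurable ψ) :
    ∫⁻ ω in {ω | (T n ω : ℝ) ≤ t ∧ t < T (n + 1) ω}, ψ (backwardWaiting (fun k => T k ω) n) ∂P
      = ENNReal.ofReal (Real.exp (-t)) * ∫⁻ w in {w | ∑ i, w i ≤ t}, ψ w ∂(orthant n) := by
  have hTm := hT.measurable
  -- Backward order: coordinate `0` is the waiting time in progress at time `t`, and the others are
  -- the completed ones.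
  set g : Fin (n + 1) → ℕ := fun i => n - i with hg
  have hginj : Function.Injective g := by
    intro i j h
    have hi := i.2
    have hj := j.2
    simp only [hg] at h
    ext
    omega
  set B : Set (Fin (n + 1) → ℝ) := {R | ∑ i : Fin n, R i.succ ≤ t ∧ t < R 0 + ∑ i : Fin n, R i.succ}
    with hB
  have hBm : MeasurableSet B :=
    (measurableSet_le (f := fun R : Fin (n + 1) → ℝ => ∑ i : Fin n, R i.succ) (by fun_prop)
      measurable_const).inter (measurableSet_lt measurable_const
      (g := fun R : Fin (n + 1) → ℝ => R 0 + ∑ i : Fin n, R i.succ) (by fun_prop))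
  have hAm : MeasurableSet {ω | (T n ω : ℝ) ≤ t ∧ t < T (n + 1) ω} :=
    (measurableSet_le (f := fun ω => (T n ω : ℝ)) (by fun_prop) measurable_const).inter
      (measurableSet_lt measurable_const (g := fun ω => (T (n + 1) ω : ℝ)) (by fun_prop))
  set F : (Fin (n + 1) → ℝ) → ℝ≥0∞ := B.indicator fun R => ψ fun i => R i.succ with hF
  have hFm : Measurable F := Measurable.indicator (by fun_prop) hBm
  have h1 : ∫⁻ ω in {ω | (T n ω : ℝ) ≤ t ∧ t < T (n + 1) ω},
        ψ (backwardWaiting (fun k => T k ω) n) ∂P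
      = ∫⁻ ω, F (fun i => (T (g i + 1) ω : ℝ) - T (g i) ω) ∂P := by
    rw [← lintegral_indicator hAm]
    refine lintegral_congr_ae ?_
    filter_upwards [hT.zero] with ω hω
    have htail : (fun i : Fin n => (T (g i.succ + 1) ω : ℝ) - T (g i.succ) ω)
        = backwardWaiting (fun k => T k ω) n := by
      ext i
      simp [backwardWaiting, hg]
    have hsum : ∑ i : Fin n, ((T (g i.succ + 1) ω : ℝ) - T (g i.succ) ω) = T n ω := by
      have := sum_backwardWaiting (fun k => T k ω) n
      rw [← htail] at this
      rw [this, hω, NNReal.coe_zero, sub_zero]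
    have hmem : (fun i => (T (g i + 1) ω : ℝ) - T (g i) ω) ∈ B
        ↔ (T n ω : ℝ) ≤ t ∧ t < T (n + 1) ω := by
      rw [hB, Set.mem_ofPred_eq, hsum]
      simp [hg]
    by_cases h : (T n ω : ℝ) ≤ t ∧ t < T (n + 1) ω
    · rw [Set.indicator_of_mem (by exact h), hF, Set.indicator_of_mem (hmem.2 h), htail]
    · rw [Set.indicator_of_notMem (by exact h), hF, Set.indicator_of_notMem (mt hmem.1 h)]
  have h2 : ∫⁻ ω, F (fun i => (T (g i + 1) ω : ℝ) - T (g i) ω) ∂P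
      = ∫⁻ R, F R ∂(Measure.pi fun _ => expMeasure 1) := by
    rw [← hT.map_waiting hginj, lintegral_map hFm (by fun_prop)]
  have hmeas : Measurable fun p : ℝ × (Fin n → ℝ) =>
      F (Fin.insertNth (α := fun _ => ℝ) 0 p.1 p.2) :=
    hFm.comp (MeasurableEquiv.piFinSuccAbove (fun _ => ℝ) 0).symm.measurable
  rw [h1, h2, lintegral_pi_insertNth _ 0 hFm, lintegral_lintegral_swap hmeas.aemeasurable]
  -- The waiting time in progress must exceed `t - ∑ v i`, with probability `e^{-(t - ∑ v i)}`.
  -- Times the density `e^{-∑ v i}` of the completed ones, this is the constant `e^{-t}`.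
  have h3 : ∀ v : Fin n → ℝ, ∫⁻ x, F (Fin.insertNth 0 x v) ∂(expMeasure 1)
      = {w | ∑ i, w i ≤ t}.indicator
        (fun v => ENNReal.ofReal (Real.exp (-(t - ∑ i, v i))) * ψ v) v := by
    intro v
    by_cases hv : ∑ i, v i ≤ t
    · rw [Set.indicator_of_mem (by exact hv), ← expMeasure_one_Ioi (sub_nonneg.2 hv),
        mul_comm, ← lintegral_indicator_const measurableSet_Ioi]
      congr 1 with x
      simp [hF, hB, Set.indicator, hv, sub_lt_iff_lt_add]
    · rw [Set.indicator_of_notMem (by exact hv)]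
      refine lintegral_eq_zero_of_ae_eq_zero (ae_of_all _ fun x => ?_)
      simp [hF, hB, hv]
  simp only [h3]
  rw [lintegral_pi_expMeasure n (Measurable.indicator (by fun_prop) (measurableSet_sum_le n t)),
    ← lintegral_const_mul' _ _ ENNReal.ofReal_ne_top, ← lintegral_indicator (measurableSet_sum_le n t)]
  congr 1 with v
  by_cases hv : ∑ i, v i ≤ t
  · rw [Set.indicator_of_mem (by exact hv), Set.indicator_of_mem (by exact hv), ← mul_assoc,
      ← ENNReal.ofReal_mul (Real.exp_pos _).le, ← Real.exp_add]
    ring_nf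
  · rw [Set.indicator_of_notMem (by exact hv), Set.indicator_of_notMem (by exact hv), mul_zero]

end Poisson

/-! ### Characteristic functions of heat kernels and of their mixture -/

section CharFun

variable {d : ℕ} {m t : ℝ}

/-- The law of Brownian motion at time `u`. -/
def heatMeasure (d : ℕ) (u : ℝ) : Measure (Space d) :=
  volume.withDensity fun y => ENNReal.ofReal (heatKernel d u 0 y)

theorem measurable_heatKernel_right (u : ℝ) : Measurable fun y : Space d => heatKernel d u 0 y := by
  unfold heatKernel; fun_prop

theorem measurable_heatKernel_uncurry :
    Measurable fun p : Space d × ℝ => heatKernel d p.2 0 p.1 := by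
  unfold heatKernel; fun_prop

theorem integrable_heatKernel {u : ℝ} (hu : 0 < u) :
    Integrable fun y : Space d => heatKernel d u 0 y := by
  have h := (GaussianFourier.integrable_cexp_neg_mul_sq_norm_add (V := Space d)
    (b := (1 / (4 * u) : ℝ)) (by rw [Complex.ofReal_re]; positivity) 0 0).norm.const_mul
    ((4 * Real.pi * u) ^ (-(d : ℝ) / 2))
  refine h.congr (ae_of_all _ fun y => ?_)
  simp only [heatKernel, sub_zero, zero_mul, add_zero, Complex.norm_exp]
  congr 2
  rw [← Complex.ofReal_neg, ← Complex.ofReal_pow, ← Complex.ofReal_mul, Complex.ofReal_re]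
  ring

theorem integral_cexp_mul_heatKernel {u : ℝ} (hu : 0 < u) (ξ : Space d) :
    ∫ y : Space d, Complex.exp (inner ℝ y ξ * Complex.I) * (heatKernel d u 0 y : ℂ)
      = (Real.exp (-(‖ξ‖ ^ 2 * u)) : ℂ) := by
  have hpi := Real.pi_pos
  have hb : 0 < ((1 / (4 * u) : ℝ) : ℂ).re := by rw [Complex.ofReal_re]; positivity
  have h := GaussianFourier.integral_cexp_neg_mul_sq_norm_add (V := Space d) hb Complex.I ξ
  have hfun : ∀ y : Space d, Complex.exp (inner ℝ y ξ * Complex.I) * (heatKernel d u 0 y : ℂ)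
      = (((4 * Real.pi * u) ^ (-(d : ℝ) / 2) : ℝ) : ℂ) *
        Complex.exp (-((1 / (4 * u) : ℝ) : ℂ) * ‖y‖ ^ 2 + Complex.I * inner ℝ ξ y) := by
    intro y
    rw [heatKernel, sub_zero, Complex.ofReal_mul, mul_left_comm, Complex.ofReal_exp,
      ← Complex.exp_add, real_inner_comm]
    congr 2
    push_cast
    ring
  simp only [hfun]
  rw [integral_const_mul, h, finrank_euclideanSpace_fin, ← mul_assoc]
  have hone : (((4 * Real.pi * u) ^ (-(d : ℝ) / 2) : ℝ) : ℂ) *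
      ((Real.pi : ℂ) / ((1 / (4 * u) : ℝ) : ℂ)) ^ ((d : ℂ) / 2) = 1 := by
    have e1 : (Real.pi : ℂ) / ((1 / (4 * u) : ℝ) : ℂ) = ((4 * Real.pi * u : ℝ) : ℂ) := by
      rw [← Complex.ofReal_div]; congr 1; field_simp
    rw [e1, show (d : ℂ) / 2 = ((d / 2 : ℝ) : ℂ) by push_cast; rfl,
      ← Complex.ofReal_cpow (by positivity), ← Complex.ofReal_mul,
      ← Real.rpow_add (by positivity), neg_div, neg_add_cancel, Real.rpow_zero, Complex.ofReal_one]
  rw [hone, one_mul, Complex.ofReal_exp]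
  congr 1
  rw [Complex.I_sq]
  push_cast
  have : (u : ℂ) ≠ 0 := by exact_mod_cast hu.ne'
  field_simp

theorem integral_heatKernel {u : ℝ} (hu : 0 < u) : ∫ y : Space d, heatKernel d u 0 y = 1 := by
  have h := integral_cexp_mul_heatKernel hu (0 : Space d)
  simp only [inner_zero_right, Complex.ofReal_zero, zero_mul, Complex.exp_zero, one_mul, norm_zero,
    ne_eq, OfNat.ofNat_ne_zero, not_false_eq_true, zero_pow, neg_zero, Real.exp_zero] at h
  rw [integral_complex_ofReal] at h
  exact_mod_cast h

theorem lintegral_heatKernel {u : ℝ} (hu : 0 < u) :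
    ∫⁻ y : Space d, ENNReal.ofReal (heatKernel d u 0 y) = 1 := by
  rw [← ofReal_integral_eq_lintegral_ofReal (integrable_heatKernel hu)
    (ae_of_all _ fun y => heatKernel_nonneg hu.le 0 y), integral_heatKernel hu, ENNReal.ofReal_one]

theorem charFun_withDensity_ofReal {f : Space d → ℝ} (hf : Measurable f) (hf0 : ∀ y, 0 ≤ f y)
    (ξ : Space d) : charFun (volume.withDensity fun y => ENNReal.ofReal (f y)) ξ
      = ∫ y, Complex.exp (inner ℝ y ξ * Complex.I) * (f y : ℂ) := by
  rw [charFun_apply, integral_withDensity_eq_integral_toReal_smul hf.ennreal_ofReal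
    (ae_of_all _ fun _ => ENNReal.ofReal_lt_top)]
  congr 1 with y
  rw [ENNReal.toReal_ofReal (hf0 y), Complex.real_smul, mul_comm]

theorem charFun_heatMeasure {u : ℝ} (hu : 0 < u) (ξ : Space d) :
    charFun (heatMeasure d u) ξ = (Real.exp (-(‖ξ‖ ^ 2 * u)) : ℂ) := by
  rw [heatMeasure, charFun_withDensity_ofReal (measurable_heatKernel_right u)
    (fun y => heatKernel_nonneg hu.le 0 y), integral_cexp_mul_heatKernel hu]

/-- The measure with density `resetDensity d m t`. -/
def resetMeasure (d : ℕ) (m t : ℝ) : Measure (Space d) :=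
  volume.withDensity fun y => ENNReal.ofReal (resetDensity d m t y)

theorem isProbabilityMeasure_resetMeasure (hm0 : 0 < m) (hm1 : m < 1) (ht : 0 < t) :
    IsProbabilityMeasure (resetMeasure d m t) := by
  have := isProbabilityMeasure_clockLaw m ht.le
  refine ⟨?_⟩
  rw [resetMeasure, withDensity_apply _ MeasurableSet.univ, Measure.restrict_univ]
  simp only [ofReal_resetDensity hm0 hm1 ht]
  rw [lintegral_lintegral_swap measurable_heatKernel_uncurry.ennreal_ofReal.aemeasurable]
  have h : ∀ᵐ u ∂(clockLaw m t), ∫⁻ y : Space d, ENNReal.ofReal (heatKernel d u 0 y) = 1 := by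
    filter_upwards [ae_clockLaw_pos hm0 hm1 ht] with u hu using lintegral_heatKernel hu
  rw [lintegral_congr_ae h, lintegral_one, measure_univ]

/-- Fubini reduces the mixture to single heat kernels; integrability holds because each of them has
mass one. -/
theorem charFun_resetMeasure (hm0 : 0 < m) (hm1 : m < 1) (ht : 0 < t) (ξ : Space d) :
    charFun (resetMeasure d m t) ξ
      = ((∫ u, Real.exp (-(‖ξ‖ ^ 2 * u)) ∂(clockLaw m t) : ℝ) : ℂ) := by
  have hprob := isProbabilityMeasure_clockLaw m ht.le
  rw [resetMeasure, charFun_withDensity_ofReal (continuous_resetDensity hm0 hm1 ht).measurable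
    (resetDensity_nonneg hm0 hm1 ht)]
  have hmeas : Measurable fun p : Space d × ℝ =>
      Complex.exp (inner ℝ p.1 ξ * Complex.I) * (heatKernel d p.2 0 p.1 : ℂ) :=
    Measurable.mul (by fun_prop) (Complex.measurable_ofReal.comp measurable_heatKernel_uncurry)
  have hnorm : ∀ (y : Space d) (u : ℝ),
      ‖Complex.exp (inner ℝ y ξ * Complex.I) * (heatKernel d u 0 y : ℂ)‖
        = ‖heatKernel d u 0 y‖ := by
    intro y u
    rw [norm_mul, Complex.norm_exp_ofReal_mul_I, one_mul, Complex.norm_real]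
  have hint : Integrable (fun p : Space d × ℝ =>
      Complex.exp (inner ℝ p.1 ξ * Complex.I) * (heatKernel d p.2 0 p.1 : ℂ))
      (volume.prod (clockLaw m t)) := by
    rw [integrable_prod_iff' hmeas.aestronglyMeasurable]
    simp only [hnorm]
    constructor
    · filter_upwards [ae_clockLaw_pos hm0 hm1 ht] with u hu
      refine (integrable_heatKernel hu).mono (hmeas.comp measurable_prodMk_right).aestronglyMeasurable
        (ae_of_all _ fun y => (hnorm y u).le)
    · refine (integrable_const (1 : ℝ)).congr ?_
      filter_upwards [ae_clockLaw_pos hm0 hm1 ht] with u hu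
      simp only [Real.norm_of_nonneg (heatKernel_nonneg hu.le 0 _)]
      exact (integral_heatKernel hu).symm
  have h1 : ∀ y : Space d, Complex.exp (inner ℝ y ξ * Complex.I) * (resetDensity d m t y : ℂ)
      = ∫ u, Complex.exp (inner ℝ y ξ * Complex.I) * (heatKernel d u 0 y : ℂ) ∂(clockLaw m t) := by
    intro y
    rw [resetDensity, integral_const_mul, integral_complex_ofReal]
  simp only [h1]
  rw [integral_integral_swap hint, ← integral_complex_ofReal]
  refine integral_congr_ae ?_
  filter_upwards [ae_clockLaw_pos hm0 hm1 ht] with u hu using integral_cexp_mul_heatKernel hu ξ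

end CharFun

/-! ### Resetting a Brownian path at deterministic times -/

section ResetSums

variable {d : ℕ} {Ω : Type*} [MeasurableSpace Ω] {P : Measure Ω} [IsProbabilityMeasure P]

/-- The largest multiple of `1 / (j + 1)` that is at most `x`. -/
def gridFloor (j : ℕ) (x : ℝ≥0) : ℝ≥0 := ⌊(x : ℝ) * (j + 1)⌋₊ / (j + 1)

theorem gridFloor_mono (j : ℕ) : Monotone (gridFloor j) := by
  intro x y h
  unfold gridFloor
  gcongr

theorem coe_gridFloor (j : ℕ) (x : ℝ≥0) :
    (gridFloor j x : ℝ) = ⌊(x : ℝ) * (j + 1)⌋₊ / (j + 1) := by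
  simp [gridFloor]

theorem gridFloor_le (j : ℕ) (x : ℝ≥0) : gridFloor j x ≤ x := by
  rw [← NNReal.coe_le_coe, coe_gridFloor, div_le_iff₀ (by positivity)]
  exact Nat.floor_le (by positivity)

theorem tendsto_gridFloor (x : ℝ≥0) : Tendsto (fun j => gridFloor j x) atTop (𝓝 x) := by
  have h := (tendsto_nat_floor_mul_div_atTop (R := ℝ) x.2).comp
    (tendsto_natCast_atTop_atTop.comp (tendsto_add_atTop_nat 1))
  rw [← NNReal.tendsto_coe]
  refine h.congr fun j => ?_
  simp only [Function.comp_apply, coe_gridFloor, Nat.cast_add, Nat.cast_one]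
  rfl

/-- The times `τ 0, …, τ n, t`. -/
def stoppedTimes (τ : ℕ → ℝ≥0) (t : ℝ≥0) (n k : ℕ) : ℝ≥0 := if k ≤ n then τ k else t

theorem stoppedTimes_mono {τ : ℕ → ℝ≥0} (hτ : Monotone τ) {t : ℝ≥0} {n : ℕ} (h : τ n ≤ t) :
    Monotone (stoppedTimes τ t n) := by
  intro i j hij
  unfold stoppedTimes
  split_ifs with h1 h2
  · exact hτ hij
  · exact (hτ h1).trans h
  · omega
  · exact le_rfl

/-- The value at time `σ (n + 1)` of a path `y` that is reset by the factor `c` at the times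
`σ 1, …, σ n`. -/
def resetSum (c : ℝ) (y : ℝ≥0 → Space d) (σ : ℕ → ℝ≥0) (n : ℕ) : Space d :=
  ∑ k ∈ Finset.range (n + 1), c ^ (n - k) • (y (σ (k + 1)) - y (σ k))

/-- The variance parameter of `resetSum` for a Brownian path. -/
def resetVar (m : ℝ) (σ : ℕ → ℝ≥0) (n : ℕ) : ℝ :=
  ∑ k ∈ Finset.range (n + 1), m ^ (n - k) * ((σ (k + 1) : ℝ) - σ k)

/-- The stretch since the last reset has length `t - ∑ w i` and weight one; the stretch with
backward index `i` has weight `m^(i+1)`. Adding up gives `clock`. -/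
theorem resetVar_stoppedTimes (m : ℝ) {τ : ℕ → ℝ≥0} (hτ : τ 0 = 0) (t : ℝ≥0) (n : ℕ) :
    resetVar m (stoppedTimes τ t n) n = clock m t (backwardWaiting τ n) := by
  have hsum := sum_backwardWaiting τ n
  rw [hτ, NNReal.coe_zero, sub_zero] at hsum
  have h1 : ∑ i : Fin n, m ^ ((i : ℕ) + 1) * backwardWaiting τ n i
      = ∑ k ∈ Finset.range n, m ^ (n - k) * ((τ (k + 1) : ℝ) - τ k) := by
    rw [← Finset.sum_range_reflect]
    have h2 := Fin.sum_univ_eq_sum_range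
      (fun i => m ^ (i + 1) * ((τ (n - (i + 1) + 1) : ℝ) - τ (n - (i + 1)))) n
    refine h2.trans (Finset.sum_congr rfl fun i hi => ?_)
    have hi := Finset.mem_range.1 hi
    rw [show n - 1 - i = n - (i + 1) by omega, show n - (n - (i + 1)) = i + 1 by omega]
  have h2 : ∑ k ∈ Finset.range n, m ^ (n - k) *
      ((stoppedTimes τ t n (k + 1) : ℝ) - stoppedTimes τ t n k)
      = ∑ k ∈ Finset.range n, m ^ (n - k) * ((τ (k + 1) : ℝ) - τ k) := by
    refine Finset.sum_congr rfl fun k hk => ?_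
    have hk := Finset.mem_range.1 hk
    rw [stoppedTimes, stoppedTimes, if_pos (by omega), if_pos (by omega)]
  rw [resetVar, Finset.sum_range_succ, h2, ← h1, clock]
  simp only [sub_mul, one_mul, Finset.sum_sub_distrib, hsum]
  rw [stoppedTimes, stoppedTimes, if_neg (by omega), if_pos le_rfl]
  simp
  ring

variable {Y : ℝ≥0 → Ω → Space d}

theorem IsBrownianMotion.charFun_increment {x : Space d} (hY : IsBrownianMotion x Y P) {s t : ℝ≥0}
    (hst : s ≤ t) (ξ : Space d) :
    charFun (P.map fun ω => Y t ω - Y s ω) ξ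
      = (Real.exp (-(‖ξ‖ ^ 2 * ((t : ℝ) - s))) : ℂ) := by
  rcases hst.eq_or_lt with rfl | h
  · simp
  · rw [(hY.law_increment s t h).map_eq]
    exact charFun_heatMeasure (sub_pos.2 (by exact_mod_cast h)) ξ

/-- The increments are independent Gaussians, and scaling one by `c^(n-k)` multiplies its variance
by `(c²)^(n-k)`; the characteristic functions multiply. -/
theorem IsBrownianMotion.integral_cexp_resetSum {x : Space d} (hY : IsBrownianMotion x Y P) (c : ℝ)
    {σ : ℕ → ℝ≥0} (hσ : Monotone σ) (n : ℕ) (ξ : Space d) :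
    ∫ ω, Complex.exp (inner ℝ (resetSum c (fun s => Y s ω) σ n) ξ * Complex.I) ∂P
      = (Real.exp (-(‖ξ‖ ^ 2 * resetVar (c ^ 2) σ n)) : ℂ) := by
  have hYm := hY.measurable
  set Δ : ℕ → Ω → Space d := fun k ω => c ^ (n - k) • (Y (σ (k + 1)) ω - Y (σ k) ω) with hΔ
  have hΔm : ∀ k, Measurable (Δ k) := fun k => by simp only [hΔ]; fun_prop
  have hind : iIndepFun Δ P := (hY.indep_increments.nat hσ).comp
    (fun k v => c ^ (n - k) • v) (fun k => by fun_prop)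
  have hsum : Measurable fun ω => ∑ k ∈ Finset.range (n + 1), Δ k ω := by fun_prop
  have h1 := congrFun (iIndepFun.charFun_map_fun_finsetSum_eq_prod (s := Finset.range (n + 1))
    (fun k _ => (hΔm k).aemeasurable) (hind.restrict _)) ξ
  rw [charFun_apply, integral_map hsum.aemeasurable
    (by fun_prop : Measurable _).aestronglyMeasurable] at h1
  refine h1.trans ?_
  rw [Finset.prod_apply]
  have h2 : ∀ k, charFun (P.map (Δ k)) ξ
      = (Real.exp (-(‖ξ‖ ^ 2 * ((c ^ 2) ^ (n - k) * ((σ (k + 1) : ℝ) - σ k)))) : ℂ) := by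
    intro k
    rw [hΔ, charFun_map_smul_comp (by fun_prop), hY.charFun_increment (hσ k.le_succ), norm_smul]
    congr 2
    rw [mul_pow, Real.norm_eq_abs, sq_abs]
    ring
  simp only [h2]
  rw [← Complex.ofReal_prod, ← Real.exp_sum, resetVar, Finset.mul_sum, Finset.sum_neg_distrib]

end ResetSums

/-! ### From deterministic to random reset times, by discretization -/

section Arrivals

variable {d : ℕ}

/-- The nondecreasing sequences of times of which exactly `τ 1, …, τ n` are at most `t`. -/
def arrivalSet (t : ℝ≥0) (n : ℕ) : Set (ℕ → ℝ≥0) :=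
  (⋂ k, {τ | τ k ≤ τ (k + 1)}) ∩ ({τ | τ n ≤ t} ∩ {τ | t < τ (n + 1)})

theorem mem_arrivalSet {t : ℝ≥0} {n : ℕ} {τ : ℕ → ℝ≥0} :
    τ ∈ arrivalSet t n ↔ Monotone τ ∧ τ n ≤ t ∧ t < τ (n + 1) := by
  rw [arrivalSet, Set.mem_inter_iff, Set.mem_iInter]
  exact and_congr_left fun _ => ⟨fun h => monotone_nat_of_le_succ fun k => h k, fun h k => h k.le_succ⟩

theorem measurableSet_arrivalSet (t : ℝ≥0) (n : ℕ) : MeasurableSet (arrivalSet t n) :=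
  (MeasurableSet.iInter fun k => measurableSet_le (measurable_pi_apply k)
    (measurable_pi_apply (k + 1))).inter
  ((measurableSet_le (measurable_pi_apply n) measurable_const).inter
    (measurableSet_lt measurable_const (measurable_pi_apply (n + 1))))

theorem disjoint_arrivalSet {t : ℝ≥0} {n k : ℕ} (h : n ≠ k) :
    Disjoint (arrivalSet t n) (arrivalSet t k) := by
  wlog hlt : n < k generalizing n k
  · exact (this h.symm (lt_of_le_of_ne (not_lt.1 hlt) h.symm)).symm
  rw [Set.disjoint_left]
  intro τ h1 h2
  rw [mem_arrivalSet] at h1 h2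
  exact absurd (h1.2.2.trans_le ((h1.1 hlt).trans h2.2.1)) (lt_irrefl t)

/-- Evaluating an arbitrary path at a random time is in general not measurable for the product
σ-algebra. The rounded time takes countably many values, which restores measurability and permits
Fubini on the space of paths and times. -/
theorem measurable_eval_gridFloor (j k : ℕ) :
    Measurable fun p : (ℝ≥0 → Space d) × (ℕ → ℝ≥0) => p.1 (gridFloor j (p.2 k)) := by
  have h1 : Measurable fun q : (ℝ≥0 → Space d) × ℕ => q.1 ((q.2 : ℝ≥0) / (j + 1)) :=
    measurable_from_prod_countable_left fun i => measurable_pi_apply ((i : ℝ≥0) / (j + 1))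
  have h2 : Measurable fun p : (ℝ≥0 → Space d) × (ℕ → ℝ≥0) =>
      (p.1, ⌊((p.2 k : ℝ≥0) : ℝ) * (j + 1)⌋₊) :=
    measurable_fst.prodMk (Nat.measurable_floor.comp (by fun_prop))
  exact h1.comp h2

/-- The times `τ 0, …, τ n` rounded down to the grid of mesh `1 / (j + 1)`, followed by `t`. -/
def gridTimes (j : ℕ) (τ : ℕ → ℝ≥0) (t : ℝ≥0) (n : ℕ) : ℕ → ℝ≥0 :=
  stoppedTimes (fun k => gridFloor j (τ k)) t n

theorem gridTimes_mono {τ : ℕ → ℝ≥0} {t : ℝ≥0} {n : ℕ} (h : τ ∈ arrivalSet t n) (j : ℕ) :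
    Monotone (gridTimes j τ t n) :=
  stoppedTimes_mono ((gridFloor_mono j).comp (mem_arrivalSet.1 h).1)
    ((gridFloor_le j _).trans (mem_arrivalSet.1 h).2.1)

theorem tendsto_gridTimes (τ : ℕ → ℝ≥0) (t : ℝ≥0) (n k : ℕ) :
    Tendsto (fun j => gridTimes j τ t n k) atTop (𝓝 (stoppedTimes τ t n k)) := by
  unfold gridTimes stoppedTimes
  split_ifs
  · exact tendsto_gridFloor (τ k)
  · exact tendsto_const_nhds

theorem measurable_eval_gridTimes (t : ℝ≥0) (n j k : ℕ) :
    Measurable fun p : (ℝ≥0 → Space d) × (ℕ → ℝ≥0) => p.1 (gridTimes j p.2 t n k) := by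
  unfold gridTimes stoppedTimes
  split_ifs
  · exact measurable_eval_gridFloor j k
  · exact (measurable_pi_apply t).comp measurable_fst

theorem measurable_resetSum_gridTimes (c : ℝ) (t : ℝ≥0) (n j : ℕ) :
    Measurable fun p : (ℝ≥0 → Space d) × (ℕ → ℝ≥0) =>
      resetSum c p.1 (gridTimes j p.2 t n) n := by
  have h := measurable_eval_gridTimes (d := d) t n j
  unfold resetSum
  fun_prop

theorem tendsto_resetSum_gridTimes (c : ℝ) {y : ℝ≥0 → Space d} (hy : Continuous y) (τ : ℕ → ℝ≥0)
    (t : ℝ≥0) (n : ℕ) :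
    Tendsto (fun j => resetSum c y (gridTimes j τ t n) n) atTop
      (𝓝 (resetSum c y (stoppedTimes τ t n) n)) :=
  tendsto_finsetSum _ fun k _ =>
    (((hy.tendsto _).comp (tendsto_gridTimes τ t n (k + 1))).sub
      ((hy.tendsto _).comp (tendsto_gridTimes τ t n k))).const_smul _

theorem tendsto_resetVar_gridTimes (m : ℝ) (τ : ℕ → ℝ≥0) (t : ℝ≥0) (n : ℕ) :
    Tendsto (fun j => resetVar m (gridTimes j τ t n) n) atTop
      (𝓝 (resetVar m (stoppedTimes τ t n) n)) :=
  tendsto_finsetSum _ fun k _ =>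
    ((NNReal.tendsto_coe.2 (tendsto_gridTimes τ t n (k + 1))).sub
      (NNReal.tendsto_coe.2 (tendsto_gridTimes τ t n k))).const_mul _

theorem measurable_gridFloor (j : ℕ) : Measurable (gridFloor j) := (gridFloor_mono j).measurable

theorem measurable_resetVar_gridTimes (m : ℝ) (t : ℝ≥0) (n j : ℕ) :
    Measurable fun τ : ℕ → ℝ≥0 => resetVar m (gridTimes j τ t n) n := by
  have h : ∀ k, Measurable fun τ : ℕ → ℝ≥0 => gridTimes j τ t n k := by
    intro k
    unfold gridTimes stoppedTimes
    split_ifs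
    · exact (measurable_gridFloor j).comp (measurable_pi_apply k)
    · exact measurable_const
  unfold resetVar
  fun_prop

theorem resetVar_nonneg {m : ℝ} (hm : 0 ≤ m) {σ : ℕ → ℝ≥0} (hσ : Monotone σ) (n : ℕ) :
    0 ≤ resetVar m σ n :=
  Finset.sum_nonneg fun k _ => mul_nonneg (by positivity)
    (sub_nonneg.2 (by exact_mod_cast hσ k.le_succ))

variable {Ω : Type*} [MeasurableSpace Ω] {P : Measure Ω}
  {Y : ℝ≥0 → Ω → Space d} {T : ℕ → Ω → ℝ≥0} {x : Space d}

theorem measurableSet_preimage_arrivalSet (hTm : ∀ n, Measurable (T n)) (t : ℝ≥0) (n : ℕ) :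
    MeasurableSet {ω | (fun k => T k ω) ∈ arrivalSet t n} :=
  (measurable_pi_lambda (fun ω k => T k ω) hTm) (measurableSet_arrivalSet t n)

theorem aemeasurable_resetSum (hY : IsBrownianMotion x Y P) (hTm : ∀ n, Measurable (T n))
    (c : ℝ) (t : ℝ≥0) (n : ℕ) :
    AEMeasurable (fun ω => resetSum c (fun s => Y s ω) (stoppedTimes (fun k => T k ω) t n) n) P := by
  have hYm : Measurable fun ω t => Y t ω := measurable_pi_lambda _ hY.measurable
  have hTm' : Measurable fun ω n => T n ω := measurable_pi_lambda _ hTm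
  refine aemeasurable_of_tendsto_metrizable_ae atTop (fun j =>
    ((measurable_resetSum_gridTimes (d := d) c t n j).comp (hYm.prodMk hTm')).aemeasurable) ?_
  filter_upwards [hY.continuous_paths] with ω hω
  exact tendsto_resetSum_gridTimes c hω (fun k => T k ω) t n

variable [IsProbabilityMeasure P]

/-- By independence the arrival times can be frozen, and for each frozen sequence the deterministic
computation applies. Rounding keeps the times monotone. -/
theorem setIntegral_cexp_resetSum_gridTimes (hY : IsBrownianMotion x Y P)
    (hTm : ∀ n, Measurable (T n)) (hind : IndepFun (fun ω t => Y t ω) (fun ω n => T n ω) P)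
    (c : ℝ) (t : ℝ≥0) (n j : ℕ) (ξ : Space d) :
    ∫ ω in {ω | (fun k => T k ω) ∈ arrivalSet t n}, Complex.exp
        (inner ℝ (resetSum c (fun s => Y s ω) (gridTimes j (fun k => T k ω) t n) n) ξ * Complex.I) ∂P
      = ∫ ω in {ω | (fun k => T k ω) ∈ arrivalSet t n},
        (Real.exp (-(‖ξ‖ ^ 2 * resetVar (c ^ 2) (gridTimes j (fun k => T k ω) t n) n)) : ℂ) ∂P := by
  have hAm := measurableSet_preimage_arrivalSet hTm t n
  have hYm : Measurable fun ω t => Y t ω := measurable_pi_lambda _ hY.measurable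
  have hTm' : Measurable fun ω n => T n ω := measurable_pi_lambda _ hTm
  set G : (ℝ≥0 → Space d) × (ℕ → ℝ≥0) → ℂ := fun p =>
    Complex.exp (inner ℝ (resetSum c p.1 (gridTimes j p.2 t n) n) ξ * Complex.I) with hG
  have hGm : Measurable G := by
    have := measurable_resetSum_gridTimes (d := d) c t n j
    simp only [hG]
    fun_prop
  set F : (ℝ≥0 → Space d) × (ℕ → ℝ≥0) → ℂ := (Prod.snd ⁻¹' arrivalSet t n).indicator G with hF
  have hFm : Measurable F := hGm.indicator (measurable_snd (measurableSet_arrivalSet t n))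
  have hGnorm : ∀ p, ‖G p‖ ≤ 1 := fun p => (Complex.norm_exp_ofReal_mul_I _).le
  have hFnorm : ∀ p, ‖F p‖ ≤ 1 := fun p => (norm_indicator_le_norm_self G p).trans (hGnorm p)
  have hprobY : IsProbabilityMeasure (P.map fun ω t => Y t ω) :=
    Measure.isProbabilityMeasure_map hYm.aemeasurable
  have hprobT : IsProbabilityMeasure (P.map fun ω n => T n ω) :=
    Measure.isProbabilityMeasure_map hTm'.aemeasurable
  have hFint : Integrable F ((P.map fun ω t => Y t ω).prod (P.map fun ω n => T n ω)) :=
    (integrable_const (1 : ℝ)).mono' hFm.aestronglyMeasurable (ae_of_all _ hFnorm)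
  have hprod := (indepFun_iff_map_prod_eq_prod_map_map hYm.aemeasurable hTm'.aemeasurable).1 hind
  set H : (ℕ → ℝ≥0) → ℂ := (arrivalSet t n).indicator fun τ =>
    (Real.exp (-(‖ξ‖ ^ 2 * resetVar (c ^ 2) (gridTimes j τ t n) n)) : ℂ) with hH
  have hHm : Measurable H := by
    have := measurable_resetVar_gridTimes (c ^ 2) t n j
    exact Measurable.indicator (by fun_prop) (measurableSet_arrivalSet t n)
  have hinner : ∀ τ, ∫ y, F (y, τ) ∂(P.map fun ω t => Y t ω) = H τ := by
    intro τ
    have hFτ : Measurable fun y => F (y, τ) := hFm.comp measurable_prodMk_right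
    rw [integral_map hYm.aemeasurable hFτ.aestronglyMeasurable]
    by_cases h : τ ∈ arrivalSet t n
    · have h1 : ∀ y, F (y, τ) = G (y, τ) := fun y => Set.indicator_of_mem (by exact h) G
      simp only [h1, hG, hH]
      rw [Set.indicator_of_mem h]
      exact hY.integral_cexp_resetSum c (gridTimes_mono h j) n ξ
    · have h1 : ∀ y, F (y, τ) = 0 := fun y => Set.indicator_of_notMem (by exact h) G
      simp only [h1, hH, integral_zero]
      rw [Set.indicator_of_notMem h]
  calc _ = ∫ ω, F (fun t => Y t ω, fun k => T k ω) ∂P := by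
        rw [← integral_indicator hAm]; rfl
    _ = ∫ p, F p ∂((P.map fun ω t => Y t ω).prod (P.map fun ω n => T n ω)) := by
        rw [← hprod, integral_map (hYm.prodMk hTm').aemeasurable hFm.aestronglyMeasurable]
    _ = ∫ τ, H τ ∂(P.map fun ω n => T n ω) := by
        rw [integral_prod_symm _ hFint]; simp only [hinner]
    _ = _ := by
        rw [integral_map hTm'.aemeasurable hHm.aestronglyMeasurable, ← integral_indicator hAm]; rfl

/-- The mesh tends to zero: path continuity gives convergence of the sums, and all integrands are
bounded by one on the event. -/
theorem setIntegral_cexp_resetSum (hY : IsBrownianMotion x Y P)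
    (hTm : ∀ n, Measurable (T n)) (hind : IndepFun (fun ω t => Y t ω) (fun ω n => T n ω) P)
    (c : ℝ) (t : ℝ≥0) (n : ℕ) (ξ : Space d) :
    ∫ ω in {ω | (fun k => T k ω) ∈ arrivalSet t n}, Complex.exp
        (inner ℝ (resetSum c (fun s => Y s ω) (stoppedTimes (fun k => T k ω) t n) n) ξ *
          Complex.I) ∂P
      = ∫ ω in {ω | (fun k => T k ω) ∈ arrivalSet t n},
        (Real.exp (-(‖ξ‖ ^ 2 * resetVar (c ^ 2) (stoppedTimes (fun k => T k ω) t n) n)) : ℂ) ∂P := by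
  have hAm := measurableSet_preimage_arrivalSet hTm t n
  have hYm : Measurable fun ω t => Y t ω := measurable_pi_lambda _ hY.measurable
  have hTm' : Measurable fun ω n => T n ω := measurable_pi_lambda _ hTm
  have hlim₁ := tendsto_integral_of_dominated_convergence
    (μ := P.restrict {ω | (fun k => T k ω) ∈ arrivalSet t n})
    (F := fun j ω => Complex.exp (inner ℝ (resetSum c (fun s => Y s ω)
      (gridTimes j (fun k => T k ω) t n) n) ξ * Complex.I))
    (f := fun ω => Complex.exp (inner ℝ (resetSum c (fun s => Y s ω)
      (stoppedTimes (fun k => T k ω) t n) n) ξ * Complex.I)) (fun _ => 1)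
    (fun j => by
      have := (measurable_resetSum_gridTimes (d := d) c t n j).comp (hYm.prodMk hTm')
      have h2 : Measurable fun ω => resetSum c (fun s => Y s ω)
        (gridTimes j (fun k => T k ω) t n) n := this
      exact (by fun_prop : Measurable _).aestronglyMeasurable)
    (integrable_const 1) (fun j => ae_of_all _ fun ω => (Complex.norm_exp_ofReal_mul_I _).le)
    (ae_restrict_of_ae (by
      filter_upwards [hY.continuous_paths] with ω hω
      have h := tendsto_resetSum_gridTimes c hω (fun k => T k ω) t n
      have hc : Continuous fun v : Space d => Complex.exp (inner ℝ v ξ * Complex.I) := by fun_prop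
      exact (hc.tendsto _).comp h))
  have hlim₂ := tendsto_integral_of_dominated_convergence
    (μ := P.restrict {ω | (fun k => T k ω) ∈ arrivalSet t n})
    (F := fun j ω => (Real.exp (-(‖ξ‖ ^ 2 * resetVar (c ^ 2)
      (gridTimes j (fun k => T k ω) t n) n)) : ℂ))
    (f := fun ω => (Real.exp (-(‖ξ‖ ^ 2 * resetVar (c ^ 2)
      (stoppedTimes (fun k => T k ω) t n) n)) : ℂ)) (fun _ => 1)
    (fun j => by
      have h2 : Measurable fun ω => resetVar (c ^ 2) (gridTimes j (fun k => T k ω) t n) n :=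
        (measurable_resetVar_gridTimes (c ^ 2) t n j).comp hTm'
      exact (by fun_prop : Measurable _).aestronglyMeasurable)
    (integrable_const 1) (fun j => by
      filter_upwards [ae_restrict_mem hAm] with ω hω
      rw [Complex.norm_real, Real.norm_of_nonneg (Real.exp_pos _).le, Real.exp_le_one_iff,
        neg_nonpos]
      exact mul_nonneg (sq_nonneg _) (resetVar_nonneg (sq_nonneg c) (gridTimes_mono hω j) n))
    (ae_of_all _ fun ω => by
      have h := tendsto_resetVar_gridTimes (c ^ 2) (fun k => T k ω) t n
      have hc : Continuous fun v : ℝ => (Real.exp (-(‖ξ‖ ^ 2 * v)) : ℂ) := by fun_prop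
      exact (hc.tendsto _).comp h)
  refine tendsto_nhds_unique hlim₁ (hlim₂.congr fun j => ?_)
  exact (setIntegral_cexp_resetSum_gridTimes hY hTm hind c t n j ξ).symm

end Arrivals

/-! ### The law of the reset process -/

section Law

variable {d : ℕ}

theorem resetSum_succ (c : ℝ) (y : ℝ≥0 → Space d) (τ : ℕ → ℝ≥0) (t : ℝ≥0) (n : ℕ) :
    resetSum c y (stoppedTimes τ t (n + 1)) (n + 1)
      = c • resetSum c y (stoppedTimes τ (τ (n + 1)) n) n + (y t - y (τ (n + 1))) := by
  unfold resetSum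
  rw [Finset.sum_range_succ, Finset.smul_sum]
  congr 1
  · refine Finset.sum_congr rfl fun k hk => ?_
    have hk := Finset.mem_range.1 hk
    -- At `k = n` the index passes the cut-off, but the terminal time is itself `τ (n + 1)`.
    have h1 : stoppedTimes τ (τ (n + 1)) n (k + 1) = τ (k + 1) := by
      unfold stoppedTimes
      split_ifs with h
      · rfl
      · rw [show k = n by omega]
    rw [h1, smul_smul, ← pow_succ', show n + 1 - k = n - k + 1 by omega, stoppedTimes,
      if_pos (by omega), stoppedTimes, if_pos (by omega), stoppedTimes, if_pos (by omega)]
  · simp [stoppedTimes]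

theorem continuous_resetSum_stoppedTimes (c : ℝ) {y : ℝ≥0 → Space d} (hy : Continuous y)
    (τ : ℕ → ℝ≥0) (n : ℕ) : Continuous fun t => resetSum c y (stoppedTimes τ t n) n := by
  have h : ∀ k, Continuous fun t => stoppedTimes τ t n k := by
    intro k
    unfold stoppedTimes
    split_ifs <;> fun_prop
  unfold resetSum
  fun_prop

/-- By induction the closed formula holds just before `τ (n + 1)`, so continuity of the path
identifies the left limit `ℓ`. Strict monotonicity makes the left neighbourhoods nontrivial, hence
the limit unique. -/
theorem eq_resetSum_of_resetting {c : ℝ} {y X : ℝ≥0 → Space d} {τ : ℕ → ℝ≥0} (hy : Continuous y)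
    (hy0 : y 0 = 0) (hτ0 : τ 0 = 0) (hτ : StrictMono τ) (h1 : ∀ t, t < τ 1 → X t = y t)
    (h2 : ∀ n, 1 ≤ n → ∃ ℓ : Space d, Tendsto X (𝓝[<] (τ n)) (𝓝 ℓ) ∧
      ∀ t, τ n ≤ t → t < τ (n + 1) → X t = c • ℓ + (y t - y (τ n))) (n : ℕ) {t : ℝ≥0}
    (ht : τ n ≤ t) (ht' : t < τ (n + 1)) : X t = resetSum c y (stoppedTimes τ t n) n := by
  induction n generalizing t with
  | zero => simp [h1 t ht', resetSum, stoppedTimes, hτ0, hy0]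
  | succ n ih =>
    obtain ⟨ℓ, hℓ, hX⟩ := h2 (n + 1) (by omega)
    have hlt : τ n < τ (n + 1) := hτ n.lt_succ_self
    have hne : (𝓝[<] (τ (n + 1))).NeBot := nhdsLT_neBot_of_exists_lt ⟨_, hlt⟩
    have hcont := ((continuous_resetSum_stoppedTimes c hy τ n).tendsto (τ (n + 1))).mono_left
      (nhdsWithin_le_nhds (s := Set.Iio (τ (n + 1))))
    have heq : X =ᶠ[𝓝[<] (τ (n + 1))] fun s => resetSum c y (stoppedTimes τ s n) n := by
      filter_upwards [Ioo_mem_nhdsLT hlt] with s hs using ih hs.1.le hs.2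
    rw [hX t ht ht', tendsto_nhds_unique hℓ (hcont.congr' heq.symm), resetSum_succ]

variable {Ω : Type*} [MeasurableSpace Ω] {P : Measure Ω}
  {Y : ℝ≥0 → Ω → Space d} {T : ℕ → Ω → ℝ≥0} {X : ℝ≥0 → Ω → Space d}

theorem IsPoissonArrivals.ae_strictMono (hT : IsPoissonArrivals T P) :
    ∀ᵐ ω ∂P, StrictMono fun n => T n ω := by
  have h : ∀ n, ∀ᵐ ω ∂P, T n ω < T (n + 1) ω := by
    intro n
    have h1 : ∀ᵐ x ∂(expMeasure 1), x ∈ Set.Ioi (0 : ℝ) :=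
      (prob_compl_eq_zero_iff measurableSet_Ioi).2 (by simp [expMeasure_one_Ioi le_rfl])
    rw [← (hT.law_waiting n).map_eq] at h1
    filter_upwards [ae_of_ae_map (hT.law_waiting n).aemeasurable h1] with ω hω
    exact_mod_cast sub_pos.1 (Set.mem_Ioi.1 hω)
  filter_upwards [ae_all_iff.2 h] with ω hω using strictMono_nat_of_lt_succ hω

variable [IsProbabilityMeasure P]

/-- The variance parameter of the reset process at time `t` is distributed as `clockLaw m t`. -/
theorem IsPoissonArrivals.tsum_setLIntegral (hT : IsPoissonArrivals T P) (m : ℝ) (t : ℝ≥0)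
    {φ : ℝ → ℝ≥0∞} (hφ : Measurable φ) :
    ∑' n, ∫⁻ ω in {ω | (fun k => T k ω) ∈ arrivalSet t n},
        φ (resetVar m (stoppedTimes (fun k => T k ω) t n) n) ∂P
      = ∫⁻ u, φ u ∂(clockLaw m t) := by
  rw [lintegral_clockLaw m t hφ]
  congr 1 with n
  refine Eq.trans ?_ (hT.setLIntegral_eq t n (hφ.comp (measurable_clock m t n)))
  have hset : {ω | (fun k => T k ω) ∈ arrivalSet t n}
      =ᵐ[P] {ω | (T n ω : ℝ) ≤ t ∧ (t : ℝ) < T (n + 1) ω} := by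
    filter_upwards [hT.ae_strictMono] with ω hω
    refine propext ?_
    change (fun k => T k ω) ∈ arrivalSet t n ↔ (T n ω : ℝ) ≤ t ∧ (t : ℝ) < T (n + 1) ω
    rw [mem_arrivalSet, NNReal.coe_le_coe, NNReal.coe_lt_coe]
    exact and_iff_right hω.monotone
  rw [setLIntegral_congr hset]
  refine lintegral_congr_ae (ae_restrict_of_ae ?_)
  filter_upwards [hT.zero] with ω hω
  rw [resetVar_stoppedTimes m hω]

/-- The probabilities of having exactly `n` arrivals add up to the total mass of `clockLaw`, which
is one. This excludes explosion. -/
theorem IsPoissonArrivals.ae_mem_iUnion (hT : IsPoissonArrivals T P) (t : ℝ≥0) :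
    ∀ᵐ ω ∂P, ω ∈ ⋃ n, {ω | (fun k => T k ω) ∈ arrivalSet t n} := by
  have hm : ∀ n, MeasurableSet {ω | (fun k => T k ω) ∈ arrivalSet t n} :=
    measurableSet_preimage_arrivalSet hT.measurable t
  have := isProbabilityMeasure_clockLaw 0 t.coe_nonneg
  -- For `φ = 1` the parameter of `clockLaw` plays no role, so the value `0` serves.
  have h := hT.tsum_setLIntegral 0 t (φ := 1) measurable_one
  refine (prob_compl_eq_zero_iff (MeasurableSet.iUnion hm)).2 ?_
  refine (measure_iUnion (fun n k hnk => (disjoint_arrivalSet hnk).preimage _) hm).trans ?_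
  simp only [Pi.one_apply, lintegral_one, Measure.restrict_apply_univ, measure_univ] at h
  exact h

/-- The law of Brownian motion with partial resetting. -/
theorem IsResetBrownianMotion.hasLaw {c : ℝ} (hc0 : 0 < c) (hc1 : c < 1)
    (hX : IsResetBrownianMotion c 0 Y T X P) {t : ℝ≥0} (ht : 0 < t) :
    HasLaw (X t) (resetMeasure d (c ^ 2) t) P := by
  have hm0 : 0 < c ^ 2 := by positivity
  have hm1 : c ^ 2 < 1 := by nlinarith
  have ht' : (0 : ℝ) < t := by exact_mod_cast ht
  have hT := hX.poisson
  set A : ℕ → Set Ω := fun n => {ω | (fun k => T k ω) ∈ arrivalSet t n} with hA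
  have hAm : ∀ n, MeasurableSet (A n) := measurableSet_preimage_arrivalSet hT.measurable t
  have hAd : Pairwise (Function.onFun Disjoint A) :=
    fun n k hnk => (disjoint_arrivalSet hnk).preimage _
  -- The events of exactly `n` resets partition the space up to a null set. Measurability of `X t`
  -- and its characteristic function are assembled from these pieces.
  have hcover : P.restrict (⋃ n, A n) = P := Measure.restrict_eq_self_of_ae_mem (hT.ae_mem_iUnion t)
  have heq : ∀ n, ∀ᵐ ω ∂(P.restrict (A n)),
      X t ω = resetSum c (fun s => Y s ω) (stoppedTimes (fun k => T k ω) t n) n := by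
    intro n
    filter_upwards [ae_restrict_mem (hAm n), ae_restrict_of_ae hX.brownian.continuous_paths,
      ae_restrict_of_ae hX.brownian.start, ae_restrict_of_ae hT.zero,
      ae_restrict_of_ae hT.ae_strictMono, ae_restrict_of_ae hX.resetting] with ω h1 h2 h3 h4 h5 h6
    have h1 := mem_arrivalSet.1 h1
    exact eq_resetSum_of_resetting (X := fun s => X s ω) h2 h3 h4 h5 h6.1 h6.2 n h1.2.1 h1.2.2
  have hXm : AEMeasurable (X t) P := by
    rw [← hcover, aemeasurable_iUnion_iff]
    intro n
    exact ((aemeasurable_resetSum hX.brownian hT.measurable c t n).restrict).congr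
      ((heq n).mono fun ω h => h.symm)
  have := Measure.isProbabilityMeasure_map hXm
  have := isProbabilityMeasure_resetMeasure (d := d) hm0 hm1 ht'
  have := isProbabilityMeasure_clockLaw (c ^ 2) t.coe_nonneg
  refine ⟨hXm, Measure.ext_of_charFun (funext fun ξ => ?_)⟩
  have hcont : Continuous fun v : Space d => Complex.exp (inner ℝ v ξ * Complex.I) := by fun_prop
  set g : ℕ → Ω → ℝ := fun n ω =>
    Real.exp (-(‖ξ‖ ^ 2 * resetVar (c ^ 2) (stoppedTimes (fun k => T k ω) t n) n)) with hg
  have hφ : Measurable fun u : ℝ => ENNReal.ofReal (Real.exp (-(‖ξ‖ ^ 2 * u))) := by fun_prop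
  have hgm : ∀ n, Measurable (g n) := by
    intro n
    have hs : ∀ k, Measurable fun ω => stoppedTimes (fun k => T k ω) t n k := by
      intro k
      have := hT.measurable k
      unfold stoppedTimes
      split_ifs <;> fun_prop
    simp only [hg]
    unfold resetVar
    fun_prop
  have hpiece : ∀ n, ∫ ω in A n, Complex.exp (inner ℝ (X t ω) ξ * Complex.I) ∂P
      = ((∫⁻ ω in A n, ENNReal.ofReal (g n ω) ∂P).toReal : ℂ) := by
    intro n
    have h1 : ∫ ω in A n, g n ω ∂P = (∫⁻ ω in A n, ENNReal.ofReal (g n ω) ∂P).toReal :=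
      integral_eq_lintegral_of_nonneg_ae (ae_of_all _ fun ω => (Real.exp_pos _).le)
        (hgm n).aestronglyMeasurable
    rw [← h1, ← integral_complex_ofReal]
    exact (integral_congr_ae ((heq n).mono fun ω h => congrArg
      (fun v => Complex.exp (inner ℝ v ξ * Complex.I)) h)).trans
      (setIntegral_cexp_resetSum hX.brownian hT.measurable hX.indep c t n ξ)
  have hsum := hT.tsum_setLIntegral (c ^ 2) t hφ
  have hfin : ∫⁻ u, ENNReal.ofReal (Real.exp (-(‖ξ‖ ^ 2 * u))) ∂(clockLaw (c ^ 2) t) ≠ ∞ := by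
    refine ne_top_of_le_ne_top ENNReal.one_ne_top ?_
    rw [← measure_univ (μ := clockLaw (c ^ 2) t), ← lintegral_one]
    refine lintegral_mono_ae ?_
    filter_upwards [ae_clockLaw_pos hm0 hm1 ht'] with u hu
    simp only [ENNReal.ofReal_le_one, Real.exp_le_one_iff, neg_nonpos]
    positivity
  have hfin' : ∀ n, ∫⁻ ω in A n, ENNReal.ofReal (g n ω) ∂P ≠ ∞ :=
    ENNReal.ne_top_of_tsum_ne_top (hsum.trans_ne hfin)
  have hint : IntegrableOn (fun ω => Complex.exp (inner ℝ (X t ω) ξ * Complex.I)) (⋃ n, A n) P := by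
    rw [IntegrableOn, hcover]
    exact (integrable_const (1 : ℝ)).mono' (hcont.measurable.comp_aemeasurable hXm).aestronglyMeasurable
      (ae_of_all _ fun ω => (Complex.norm_exp_ofReal_mul_I _).le)
  rw [charFun_resetMeasure hm0 hm1 ht', charFun_apply,
    integral_map hXm hcont.measurable.aestronglyMeasurable]
  calc ∫ ω, Complex.exp (inner ℝ (X t ω) ξ * Complex.I) ∂P
      = ∫ ω in ⋃ n, A n, Complex.exp (inner ℝ (X t ω) ξ * Complex.I) ∂P := by rw [hcover]
    _ = ∑' n, ((∫⁻ ω in A n, ENNReal.ofReal (g n ω) ∂P).toReal : ℂ) := by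
        rw [integral_iUnion hAm hAd hint]
        simp only [hpiece]
    _ = _ := by
        rw [← Complex.ofReal_tsum, ← ENNReal.tsum_toReal_eq hfin',
          integral_eq_lintegral_of_nonneg_ae (ae_of_all _ fun u => (Real.exp_pos _).le)
            (by fun_prop : Measurable _).aestronglyMeasurable, ← hsum]

/-- Continuous densities of the same law coincide. -/
theorem IsDensityOf.eq_resetDensity {c : ℝ} (hc0 : 0 < c) (hc1 : c < 1)
    (hX : IsResetBrownianMotion c 0 Y T X P) {p : ℝ≥0 → Space d → ℝ} (hp : IsDensityOf p X P)
    {t : ℝ≥0} (ht : 0 < t) : p t = resetDensity d (c ^ 2) t := by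
  have hm0 : 0 < c ^ 2 := by positivity
  have hm1 : c ^ 2 < 1 := by nlinarith
  have ht' : (0 : ℝ) < t := by exact_mod_cast ht
  obtain ⟨hpc, hp0, hpl⟩ := hp t ht
  have hrc := continuous_resetDensity (d := d) hm0 hm1 ht'
  have h : volume.withDensity (fun y => ENNReal.ofReal (p t y))
      = volume.withDensity fun y => ENNReal.ofReal (resetDensity d (c ^ 2) t y) :=
    hpl.map_eq.symm.trans (hX.hasLaw hc0 hc1 ht).map_eq
  have hfin : ∫⁻ y, ENNReal.ofReal (p t y) ≠ ∞ := by
    rw [← setLIntegral_univ, ← withDensity_apply _ MeasurableSet.univ, ← hpl.map_eq]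
    have := Measure.isProbabilityMeasure_map hpl.aemeasurable
    simp
  rw [withDensity_eq_iff hpc.measurable.ennreal_ofReal.aemeasurable
    hrc.measurable.ennreal_ofReal.aemeasurable hfin] at h
  refine (hpc.ae_eq_iff_eq volume hrc).1 ?_
  filter_upwards [h] with y hy
  exact (ENNReal.ofReal_eq_ofReal_iff (hp0 y) (resetDensity_nonneg hm0 hm1 ht' y)).1 hy

theorem IsResetBrownianMotion.isDensityOf {c : ℝ} (hc0 : 0 < c) (hc1 : c < 1)
    (hX : IsResetBrownianMotion c 0 Y T X P) :
    IsDensityOf (fun t => resetDensity d (c ^ 2) t) X P := by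
  have hm0 : 0 < c ^ 2 := by positivity
  have hm1 : c ^ 2 < 1 := by nlinarith
  intro t ht
  have ht' : (0 : ℝ) < t := by exact_mod_cast ht
  exact ⟨continuous_resetDensity hm0 hm1 ht', resetDensity_nonneg hm0 hm1 ht',
    hX.hasLaw hc0 hc1 ht⟩

end Law

end PartialResetting

end

/-! ### The main theorem -/

theorem mainTheorem3 (d : ℕ) (hd : 1 ≤ d) (c : ℝ) (hc0 : 0 < c) (hc1 : c < 1)
    (m : ℝ) (hm : m = c ^ 2) :
    (∀ (Ω : Type*) [MeasurableSpace Ω] (P : Measure Ω) [IsProbabilityMeasure P]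
      (Y : ℝ≥0 → Ω → PartialResetting.Space d) (T : ℕ → Ω → ℝ≥0)
      (X : ℝ≥0 → Ω → PartialResetting.Space d),
      PartialResetting.IsResetBrownianMotion c 0 Y T X P →
      ∃ p : ℝ≥0 → PartialResetting.Space d → ℝ, PartialResetting.IsDensityOf p X P) ∧
    ∀ δ : ℝ, 0 < δ → ∃ (C t₀ : ℝ), 0 < C ∧ 0 < t₀ ∧
      (∀ (Ω : Type*) [MeasurableSpace Ω] (P : Measure Ω) [IsProbabilityMeasure P]
        (Y : ℝ≥0 → Ω → PartialResetting.Space d) (T : ℕ → Ω → ℝ≥0)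
        (X : ℝ≥0 → Ω → PartialResetting.Space d),
        PartialResetting.IsResetBrownianMotion c 0 Y T X P →
        ∀ p : ℝ≥0 → PartialResetting.Space d → ℝ, PartialResetting.IsDensityOf p X P →
        ∀ (t : ℝ≥0) (y : PartialResetting.Space d), t₀ ≤ t →
          m ^ 2 + δ ≤ ‖y‖ ^ 2 / (4 * (t : ℝ) ^ 2) → ‖y‖ ^ 2 / (4 * (t : ℝ) ^ 2) ≤ 1 - δ →
          |p t y - PartialResetting.rho d m y| ≤ C / t * |PartialResetting.rho d m y| ∧
          |p t y - PartialResetting.leadingTerm d m y|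
            ≤ C / t * |PartialResetting.leadingTerm d m y|) ∧
      ∀ (t : ℝ) (y : PartialResetting.Space d), t₀ ≤ t →
        m ^ 2 + δ ≤ ‖y‖ ^ 2 / (4 * t ^ 2) → ‖y‖ ^ 2 / (4 * t ^ 2) ≤ 1 - δ →
        |PartialResetting.rho d m y - PartialResetting.leadingTerm d m y|
          ≤ C / t * |PartialResetting.leadingTerm d m y| := by
  subst hm
  have hm0 : 0 < c ^ 2 := by positivity
  have hm1 : c ^ 2 < 1 := by nlinarith
  refine ⟨fun Ω _ P _ Y T X hX => ⟨_, hX.isDensityOf hc0 hc1⟩, fun δ hδ => ?_⟩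
  obtain ⟨C, t₀, hC, ht₀, h⟩ := PartialResetting.exists_asymptotics hd hm0 hm1 hδ
  -- For `t ≥ 2C` one has `C/t ≤ 1/2`, so `rho` is at least half the leading term. The triangle
  -- inequality bounds the difference of the two densities by `2C/t` times the leading term, hence
  -- by `4C/t` times `rho`.
  refine ⟨4 * C, max t₀ (2 * C), by positivity, by positivity, ?_, ?_⟩
  · intro Ω _ P _ Y T X hX p hp t y ht hl hu
    have ht1 : t₀ ≤ t := (le_max_left _ _).trans ht
    have htC : 2 * C ≤ t := (le_max_right _ _).trans ht
    have htpos : (0 : ℝ) < t := by linarith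
    obtain ⟨hy, hρ, hr⟩ := h t y ht1 hl hu
    rw [hp.eq_resetDensity hc0 hc1 hX (by exact_mod_cast htpos)]
    have hL := PartialResetting.leadingTerm_pos (d := d) hm0 hm1 hy
    generalize PartialResetting.leadingTerm d (c ^ 2) y = L at *
    generalize PartialResetting.rho d (c ^ 2) y = r at *
    generalize PartialResetting.resetDensity d (c ^ 2) t y = q at *
    have hs : C / t ≤ 1 / 2 := by rw [div_le_iff₀ htpos]; linarith
    have hs0 : 0 < C / t := by positivity
    rw [mul_div_assoc, abs_of_pos hL]
    generalize C / (t : ℝ) = s at *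
    rw [abs_le] at hρ hr
    have hsL : s * L ≤ 1 / 2 * L := by gcongr
    have hrL : L / 2 ≤ r := by linarith
    rw [abs_of_pos (show 0 < r by linarith), abs_le, abs_le]
    have h1 : s * (L / 2) ≤ s * r := by gcongr
    have h2 : 0 < s * L := by positivity
    refine ⟨⟨?_, ?_⟩, ?_, ?_⟩ <;> linarith
  · intro t y ht hl hu
    have ht1 : t₀ ≤ t := (le_max_left _ _).trans ht
    have htpos : 0 < t := by linarith
    obtain ⟨hy, hρ, -⟩ := h t y ht1 hl hu
    have hL := PartialResetting.leadingTerm_pos (d := d) hm0 hm1 hy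
    rw [abs_of_pos hL]
    refine hρ.trans ?_
    gcongr
    linarith
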